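/- Let $m\ge 2$, let $E$ be an oriented smooth real vector bundle of rank $4$ over $\mathbb R^m$ with a neutral metric $h$ (signature $(2,2)$), and let $\nabla$ be a flat connection of $E$ with $\nabla h=0$. Let $e=(e_1,e_2,e_3,e_4)$ be a smooth pseudo-orthonormal frame field of $E$ on $\mathbb R^m$ giving the orientation, with $e_1,e_2$ space-like and $e_3,e_4$ time-like, and let $\omega=[\omega^i_j]$ be the connection form, $\nabla e_j=\sum_i\omega^i_j\otimes e_i$. For $\varepsilon\in\{+,-\}$ put $$\Omega_{\varepsilon,2}=\tfrac1{\sqrt2}\,(e_1\wedge e_3+\varepsilon\, e_4\wedge e_2),$$ and let $\hat h$ and $\hat\nabla$ be the metric and the connection of $\bigwedge^2E$ induced by $h$ and $\nabla$. For a section $\Omega$ of $\bigwedge^2E$, $\hat\nabla\Omega$ is called fully light-like if $\hat h(\hat\nabla_X\Omega,\hat\nabla_X\Omega)=0$ for every tangent vector $X$ and if at every point $\hat\nabla_X\Omega\neq0$ for some $X$. **(1)** Both $\hat\nabla\Omega_{+,2}$ and $\hat\nabla\Omega_{-,2}$ are fully light-like if and only if there are $\mu\in\{+1,-1\}$ and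 smooth functions $f^\pm,g^\pm$ on $\mathbb R^m$, with $dg^+$ and $dg^-$ nowhere zero, such that $$\omega^3_1=\tfrac12(df^+-df^-),\qquad \omega^4_2=-\tfrac12(df^++df^-)$$ and $\omega$ has one of the following two types. Type I: $$\omega^2_1=\tfrac\mu2\big(e^{\mu f^+}dg^+-e^{\mu f^-}dg^-\big),\quad \omega^3_2=\tfrac12\big(e^{\mu f^+}dg^++e^{\mu f^-}dg^-\big),$$ $$\omega^4_1=\tfrac12\big(e^{\mu f^+}dg^+-e^{\mu f^-}dg^-\big),\quad \omega^4_3=\tfrac\mu2\big(e^{\mu f^+}dg^++e^{\mu f^-}dg^-\big).$$ Type II: $$\omega^2_1=\tfrac\mu2\big(e^{\mu f^+}dg^++e^{-\mu f^-}dg^-\big),\quad \omega^3_2=\tfrac12\big(e^{\mu f^+}dg^++e^{-\mu f^-}dg^-\big),$$ $$\omega^4_1=\tfrac12\big(e^{\mu f^+}dg^+-e^{-\mu f^-}dg^-\big),\quad \omega^4_3=\tfrac\mu2\big(e^{\mu f^+}dg^+-e^{-\mu f^-}dg^-\big).$$ For the remaining parts let $E=TE^4_2$, the tangent bundle of $E^4_2$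 ($\mathbb R^4$ with the metric $dx_1^2+dx_2^2-dx_3^2-dx_4^2$ and its standard orientation), with its Levi-Civita connection. For $\varepsilon\in\{+,-\}$, an almost $\varepsilon$-paracomplex structure of $E^4_2$ is a smooth field $J$ of endomorphisms of the tangent spaces with $J^2=\mathrm{id}$, with $\pm1$-eigenspaces of equal dimension, with $h(J\cdot,J\cdot)=-h$, and such that near each point there is an oriented pseudo-orthonormal frame field, as above, adapted to $J$, i.e. with $Je_1=e_3$, $Je_2=-\varepsilon e_4$, $Je_3=e_1$, $Je_4=-\varepsilon e_2$. The corresponding section $\Omega$ of the time-like twistor space is $\Omega_{\varepsilon,2}$ for any such frame. **(2)** Let $J_+,J_-$ be an almost $+$-paracomplex and an almost $-$-paracomplex structure of $E^4_2$, with corresponding sections $\Omega_+,\Omega_-$. Then $\hat\nabla\Omega_+$ and $\hat\nabla\Omega_-$ are both fully light-like if and only if there is a smooth oriented pseudo-orthonormal frame field $e$ on all of $\mathbb R^4$, adapted to both $J_+$ and $J_-$, whose connection form is as in (1), of type I or of type II, for some $\mu\in\{+1,-1\}$ and some smooth $f^\pm,g^\pm$ with $dg^\pm$ nowhere zero. **(3)**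 Conversely, for each $\mu\in\{+1,-1\}$, all smooth functions $f^\pm,g^\pm$ on $\mathbb R^4$ with $dg^\pm$ nowhere zero, and each of the two types, there are almost $\pm$-paracomplex structures $J_\pm$ of $E^4_2$ and a smooth oriented pseudo-orthonormal frame field $e$ on $\mathbb R^4$, adapted to both, whose connection form is given by $f^\pm,g^\pm,\mu$ in that type. -/

import Mathlib

open Bundle Set
open scoped Manifold ContDiff

noncomputable section

namespace NeutralRankFour

/-- The base space `ℝ^m`. -/
abbrev Base (m : ℕ) : Type := EuclideanSpace ℝ (Fin m)

/-- The model fibre `ℝ^4` of a vector bundle of rank `4`. -/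
abbrev Fib : Type := EuclideanSpace ℝ (Fin 4)

/-- The signs of a pseudo-orthonormal basis of signature `(2,2)`: the first two vectors are
space-like, the last two are time-like. -/
def sgn : Fin 4 → ℝ := ![1, 1, -1, -1]

/-! ### Linear algebra of the second exterior power -/

section Algebra

variable {W : Type*} [AddCommGroup W] [Module ℝ W]

/-- The bivector `a ∧ b`. -/
def wedge (a b : W) : ⋀[ℝ]^2 W := exteriorPower.ιMulti ℝ 2 ![a, b]

/-- The bilinear form induced on the second exterior power by a bilinear form `h`, i.e.
`(a ∧ b, c ∧ d) ↦ h a c * h b d - h a d * h b c`. -/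
def inducedForm (h : LinearMap.BilinForm ℝ W) : LinearMap.BilinForm ℝ (⋀[ℝ]^2 W) :=
  (exteriorPower.pairingDual ℝ W 2).comp (exteriorPower.map 2 h)

theorem inducedForm_wedge (h : LinearMap.BilinForm ℝ W) (a b c d : W) :
    inducedForm h (wedge a b) (wedge c d) = h a c * h b d - h a d * h b c := by
  simp [inducedForm, wedge, Matrix.det_fin_two, Function.comp_def]
  ring

/-- `Ω_{ε,2} = (e₁ ∧ e₃ + ε e₄ ∧ e₂) / √2` for a quadruple `b = (e₁, e₂, e₃, e₄)`. -/
def omegaTwo (ε : ℝ) (b : Fin 4 → W) : ⋀[ℝ]^2 W :=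
  (1 / √2) • (wedge (b 0) (b 2) + ε • wedge (b 3) (b 1))

/-- The quadruple `b` is adapted to the endomorphism `J`:
`J e₁ = e₃`, `J e₂ = -ε e₄`, `J e₃ = e₁`, `J e₄ = -ε e₂`. -/
def IsAdapted (ε : ℝ) (J : W →ₗ[ℝ] W) (b : Fin 4 → W) : Prop :=
  J (b 0) = b 2 ∧ J (b 1) = -ε • b 3 ∧ J (b 2) = b 0 ∧ J (b 3) = -ε • b 1

end Algebra

/-! ### Oriented neutral vector bundles of rank four over `ℝ^m` -/

section VectorBundles

variable {m : ℕ} {V : Base m → Type*} [TopologicalSpace (TotalSpace Fib V)]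
  [∀ x, AddCommGroup (V x)] [∀ x, Module ℝ (V x)] [∀ x, TopologicalSpace (V x)]
  [FiberBundle Fib V]

/-- A section of the bundle is smooth. -/
def SmoothSection (σ : Π x, V x) : Prop :=
  ContMDiff 𝓘(ℝ, Base m) (𝓘(ℝ, Base m).prod 𝓘(ℝ, Fib)) ∞ (fun x ↦ TotalSpace.mk' Fib x (σ x))

/-- A section of the bundle is differentiable at the point `x`. -/
def DiffSectionAt (σ : Π x, V x) (x : Base m) : Prop :=
  MDifferentiableAt 𝓘(ℝ, Base m) (𝓘(ℝ, Base m).prod 𝓘(ℝ, Fib))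
    (fun x ↦ TotalSpace.mk' Fib x (σ x)) x

variable (V) in
/-- A neutral metric of the bundle: a smooth field of symmetric bilinear forms of
signature `(2,2)`. -/
structure NeutralMetric where
  /-- The bilinear form on each fibre. -/
  form : ∀ x, LinearMap.BilinForm ℝ (V x)
  symm : ∀ x a b, form x a b = form x b a
  neutral : ∀ x, ∃ b : Module.Basis (Fin 4) ℝ (V x),
    ∀ i j, form x (b i) (b j) = if i = j then sgn i else 0
  smooth : ∀ σ τ : Π x, V x, SmoothSection σ → SmoothSection τ →
    ContDiff ℝ ∞ (fun x ↦ form x (σ x) (τ x))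

variable (V) in
/-- An orientation of the bundle: an orientation of each fibre which, near each point, is the one
given by some smooth local frame. -/
structure BundleOrientation where
  /-- The orientation of each fibre. -/
  orient : ∀ x, Orientation ℝ (V x) (Fin 4)
  locally_constant : ∀ x₀, ∃ u : Set (Base m), IsOpen u ∧ x₀ ∈ u ∧
    ∃ (s : Fin 4 → Π x, V x) (hs : IsLocalFrameOn 𝓘(ℝ, Base m) Fib ∞ s u),
      ∀ x (hx : x ∈ u), (hs.toBasisAt hx).orientation = orient x

/-- `e = (e₁, e₂, e₃, e₄)` is an ordered pseudo-orthonormal smooth frame field on `u` giving the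
orientation; `e₁, e₂` are space-like and `e₃, e₄` are time-like. -/
structure IsOrientedFrameOn (h : NeutralMetric V) (o : BundleOrientation V)
    (e : Fin 4 → Π x, V x) (u : Set (Base m)) : Prop where
  frame : IsLocalFrameOn 𝓘(ℝ, Base m) Fib ∞ e u
  orthonormal : ∀ x ∈ u, ∀ i j, h.form x (e i x) (e j x) = if i = j then sgn i else 0
  oriented : ∀ x (hx : x ∈ u), (frame.toBasisAt hx).orientation = o.orient x

/-- `J` is an `ε`-paracomplex structure of the bundle (`ε = 1` or `ε = -1`): a smooth field of
endomorphisms with `J² = id`, with eigenspaces for `1` and `-1` of the same dimension, with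
`h (J a) (J b) = - h a b`, and adapted locally to an oriented pseudo-orthonormal frame field. -/
structure IsParacomplex (h : NeutralMetric V) (o : BundleOrientation V) (ε : ℝ)
    (J : ∀ x, V x →ₗ[ℝ] V x) : Prop where
  smooth : ∀ σ : Π x, V x, SmoothSection σ → SmoothSection (fun x ↦ J x (σ x))
  sq : ∀ x a, J x (J x a) = a
  eigenspaces : ∀ x, Module.finrank ℝ (Module.End.eigenspace (J x) 1) =
    Module.finrank ℝ (Module.End.eigenspace (J x) (-1))
  reversing : ∀ x a b, h.form x (J x a) (J x b) = - h.form x a b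
  admissible : ∀ x₀, ∃ u : Set (Base m), IsOpen u ∧ x₀ ∈ u ∧
    ∃ e : Fin 4 → Π x, V x, IsOrientedFrameOn h o e u ∧
      ∀ x ∈ u, IsAdapted ε (J x) (fun i ↦ e i x)

/-- `Ω` is the section of the time-like twistor space which corresponds to the `ε`-paracomplex
structure `J`: in each fibre it is `Ω_{ε,2}` of an oriented pseudo-orthonormal basis adapted
to `J`. -/
def IsTwistorSection (h : NeutralMetric V) (o : BundleOrientation V) (ε : ℝ)
    (J : ∀ x, V x →ₗ[ℝ] V x) (Ω : ∀ x, ⋀[ℝ]^2 (V x)) : Prop :=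
  ∀ x, ∃ b : Module.Basis (Fin 4) ℝ (V x),
    (∀ i j, h.form x (b i) (b j) = if i = j then sgn i else 0) ∧
    b.orientation = o.orient x ∧ IsAdapted ε (J x) b ∧ Ω x = omegaTwo ε b

/-! ### Connections -/

variable [∀ x, IsTopologicalAddGroup (V x)] [∀ x, ContinuousSMul ℝ (V x)]

/-- The connection `∇` satisfies `∇ h = 0`. -/
def IsMetricConnection (h : NeutralMetric V)
    (cov : CovariantDerivative 𝓘(ℝ, Base m) Fib V) : Prop :=
  ∀ (σ τ : Π x, V x) (x : Base m), DiffSectionAt σ x → DiffSectionAt τ x → ∀ X : Base m,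
    fderiv ℝ (fun y ↦ h.form y (σ y) (τ y)) x X =
      h.form x (cov σ x X) (τ x) + h.form x (σ x) (cov τ x X)

/-- The curvature tensor
`R(X, Y) σ = ∇_X ∇_Y σ - ∇_Y ∇_X σ - ∇_{[X, Y]} σ` of the connection `∇` vanishes. -/
def IsFlatConnection (cov : CovariantDerivative 𝓘(ℝ, Base m) Fib V) : Prop :=
  ∀ (X Y : Base m → Base m) (σ : Π x, V x), ContDiff ℝ ∞ X → ContDiff ℝ ∞ Y → SmoothSection σ →
    ∀ x, cov (fun y ↦ cov σ y (Y y)) x (X x) - cov (fun y ↦ cov σ y (X y)) x (Y x)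
      - cov σ x (VectorField.lieBracket ℝ X Y x) = 0

/-- The `(i, j)`-component `ω^i_j` of the connection form of `∇` with respect to the frame field
`e`, defined by `∇_X e_j = ∑ i, ω^i_j(X) e_i`. -/
def connForm (cov : CovariantDerivative 𝓘(ℝ, Base m) Fib V) {e : Fin 4 → Π x, V x}
    (he : IsLocalFrameOn 𝓘(ℝ, Base m) Fib ∞ e univ) (i j : Fin 4) (x X : Base m) : ℝ :=
  he.coeff i x (cov (e j) x X)

variable [VectorBundle ℝ Fib V] [ContMDiffVectorBundle ∞ Fib V 𝓘(ℝ, Base m)]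

/-- The coefficient `Ω^{ij}` of a section `Ω = ∑_{i < j} Ω^{ij} s_i ∧ s_j` of the second exterior
power of the bundle with respect to a local frame `s`. -/
def wedgeCoeff {s : Fin 4 → Π x, V x} {u : Set (Base m)}
    (hs : IsLocalFrameOn 𝓘(ℝ, Base m) Fib ∞ s u) (i j : Fin 4) (Ω : ∀ x, ⋀[ℝ]^2 (V x))
    (y : Base m) : ℝ :=
  exteriorPower.pairingDual ℝ (V y) 2 (wedge (hs.coeff i y) (hs.coeff j y)) (Ω y)

/-- The connection `∇̂` of the second exterior power of the bundle induced by `∇`, characterised by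
`∇̂ (σ ∧ τ) = ∇ σ ∧ τ + σ ∧ ∇ τ`. It is computed at `x` in the local frame `s` of the bundle given
by the preferred local trivialisation at `x`: for `Ω = ∑_{i < j} Ω^{ij} s_i ∧ s_j`,
`∇̂_X Ω = ∑_{i < j} (dΩ^{ij}(X) s_i ∧ s_j + Ω^{ij} (∇_X s_i ∧ s_j + s_i ∧ ∇_X s_j))`. -/
def inducedCov (cov : CovariantDerivative 𝓘(ℝ, Base m) Fib V) (Ω : ∀ x, ⋀[ℝ]^2 (V x))
    (x X : Base m) : ⋀[ℝ]^2 (V x) :=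
  let t := trivializationAt Fib V x
  let b := (EuclideanSpace.basisFun (Fin 4) ℝ).toBasis
  let s := t.localFrame b
  let hs := t.isLocalFrameOn_localFrame_baseSet 𝓘(ℝ, Base m) ∞ b
  ∑ i : Fin 4, ∑ j ∈ Finset.Ioi i,
    (fderiv ℝ (wedgeCoeff hs i j Ω) x X • wedge (s i x) (s j x) +
      wedgeCoeff hs i j Ω x • (wedge (cov (s i) x X) (s j x) + wedge (s i x) (cov (s j) x X)))

/-- `∇̂ Ω` is fully light-like: each value `∇̂_X Ω` is light-like or zero, and `∇̂ Ω` does not vanish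
at any point. -/
def IsFullyLightLike (h : NeutralMetric V) (cov : CovariantDerivative 𝓘(ℝ, Base m) Fib V)
    (Ω : ∀ x, ⋀[ℝ]^2 (V x)) : Prop :=
  ∀ x, (∀ X, inducedForm (h.form x) (inducedCov cov Ω x X) (inducedCov cov Ω x X) = 0) ∧
    ∃ X, inducedCov cov Ω x X ≠ 0

end VectorBundles

/-! ### The two shapes of the connection form -/

section Shapes

variable {m : ℕ}

/-- `ω^3_1 = (df⁺ - df⁻) / 2` and `ω^4_2 = -(df⁺ + df⁻) / 2`. -/
def CommonShape (fp fm : Base m → ℝ) (Γ : Fin 4 → Fin 4 → Base m → Base m → ℝ) : Prop :=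
  ∀ x X,
    Γ 2 0 x X = 1 / 2 * (fderiv ℝ fp x X - fderiv ℝ fm x X) ∧
    Γ 3 1 x X = -(1 / 2) * (fderiv ℝ fp x X + fderiv ℝ fm x X)

/-- The first shape of the remaining components `ω^2_1`, `ω^3_2`, `ω^4_1`, `ω^4_3`. -/
def ShapeOne (μ : ℝ) (fp fm gp gm : Base m → ℝ)
    (Γ : Fin 4 → Fin 4 → Base m → Base m → ℝ) : Prop :=
  ∀ x X,
    Γ 1 0 x X = μ / 2 * (Real.exp (μ * fp x) * fderiv ℝ gp x X
      - Real.exp (μ * fm x) * fderiv ℝ gm x X) ∧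
    Γ 2 1 x X = 1 / 2 * (Real.exp (μ * fp x) * fderiv ℝ gp x X
      + Real.exp (μ * fm x) * fderiv ℝ gm x X) ∧
    Γ 3 0 x X = 1 / 2 * (Real.exp (μ * fp x) * fderiv ℝ gp x X
      - Real.exp (μ * fm x) * fderiv ℝ gm x X) ∧
    Γ 3 2 x X = μ / 2 * (Real.exp (μ * fp x) * fderiv ℝ gp x X
      + Real.exp (μ * fm x) * fderiv ℝ gm x X)

/-- The second shape of the remaining components `ω^2_1`, `ω^3_2`, `ω^4_1`, `ω^4_3`. -/
def ShapeTwo (μ : ℝ) (fp fm gp gm : Base m → ℝ)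
    (Γ : Fin 4 → Fin 4 → Base m → Base m → ℝ) : Prop :=
  ∀ x X,
    Γ 1 0 x X = μ / 2 * (Real.exp (μ * fp x) * fderiv ℝ gp x X
      + Real.exp (-μ * fm x) * fderiv ℝ gm x X) ∧
    Γ 2 1 x X = 1 / 2 * (Real.exp (μ * fp x) * fderiv ℝ gp x X
      + Real.exp (-μ * fm x) * fderiv ℝ gm x X) ∧
    Γ 3 0 x X = 1 / 2 * (Real.exp (μ * fp x) * fderiv ℝ gp x X
      - Real.exp (-μ * fm x) * fderiv ℝ gm x X) ∧
    Γ 3 2 x X = μ / 2 * (Real.exp (μ * fp x) * fderiv ℝ gp x X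
      - Real.exp (-μ * fm x) * fderiv ℝ gm x X)

/-- Smooth functions `f⁺, f⁻, g⁺, g⁻` on `ℝ^m` with `dg⁺`, `dg⁻` nowhere zero. -/
def IsData (fp fm gp gm : Base m → ℝ) : Prop :=
  ContDiff ℝ ∞ fp ∧ ContDiff ℝ ∞ fm ∧ ContDiff ℝ ∞ gp ∧ ContDiff ℝ ∞ gm ∧
    (∀ x, fderiv ℝ gp x ≠ 0) ∧ (∀ x, fderiv ℝ gm x ≠ 0)

/-- The connection form `ω` has one of the two shapes. -/
def HasShape (Γ : Fin 4 → Fin 4 → Base m → Base m → ℝ) : Prop :=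
  ∃ (μ : ℝ) (fp fm gp gm : Base m → ℝ), (μ = 1 ∨ μ = -1) ∧ IsData fp fm gp gm ∧
    CommonShape fp fm Γ ∧ (ShapeOne μ fp fm gp gm Γ ∨ ShapeTwo μ fp fm gp gm Γ)

end Shapes

/-! ### The flat neutral space `E^4_2` -/

section FlatSpace

/-- The tangent bundle of `ℝ^4`. -/
abbrev TE : Base 4 → Type := fun x ↦ TangentSpace 𝓘(ℝ, Base 4) x

/-- The bilinear form `x₁ y₁ + x₂ y₂ - x₃ y₃ - x₄ y₄` on `ℝ^4`. -/
def flatForm : LinearMap.BilinForm ℝ (Base 4) :=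
  LinearMap.mk₂ ℝ (fun a b : Base 4 ↦ ∑ i, sgn i * a i * b i)
    (fun a a' b ↦ by simp only [PiLp.add_apply, ← Finset.sum_add_distrib]; congr! 1; ring)
    (fun c a b ↦ by
      simp only [PiLp.smul_apply, smul_eq_mul, Finset.mul_sum]; congr! 1; ring)
    (fun a b b' ↦ by simp only [PiLp.add_apply, ← Finset.sum_add_distrib]; congr! 1; ring)
    (fun c a b ↦ by
      simp only [PiLp.smul_apply, smul_eq_mul, Finset.mul_sum]; congr! 1; ring)

theorem flatForm_apply (a b : Base 4) : flatForm a b = ∑ i, sgn i * a i * b i := rfl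

theorem flatForm_basis (i j : Fin 4) :
    flatForm ((EuclideanSpace.basisFun (Fin 4) ℝ).toBasis i)
      ((EuclideanSpace.basisFun (Fin 4) ℝ).toBasis j) = if i = j then sgn i else 0 := by
  by_cases hij : i = j
  · simp [flatForm_apply, PiLp.single_apply, hij]
  · simp [flatForm_apply, PiLp.single_apply, hij, Ne.symm hij]

theorem contDiff_flatForm {σ τ : Base 4 → Base 4} (hσ : ContDiff ℝ ∞ σ) (hτ : ContDiff ℝ ∞ τ) :
    ContDiff ℝ ∞ (fun x ↦ flatForm (σ x) (τ x)) :=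
  ContDiff.sum (s := Finset.univ) (f := fun i x ↦ sgn i * σ x i * τ x i) fun i _ ↦
    (contDiff_const.mul (contDiff_euclidean.1 hσ i)).mul (contDiff_euclidean.1 hτ i)

theorem smoothSection_iff (σ : Base 4 → Base 4) :
    SmoothSection (V := TE) σ ↔ ContDiff ℝ ∞ σ := by
  rw [contDiff_iff_contDiffAt]
  exact forall_congr' fun x ↦ contMDiffAt_vectorSpace_iff_contDiffAt

theorem diffSectionAt_iff (σ : Base 4 → Base 4) (x : Base 4) :
    DiffSectionAt (V := TE) σ x ↔ DifferentiableAt ℝ σ x := by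
  refine (mdifferentiableAt_section 𝓘(ℝ, Base 4) (E := TE) σ).trans ?_
  rw [← mdifferentiableAt_iff_differentiableAt]
  simp

/-- The neutral metric of `E^4_2`. -/
def flatMetric : NeutralMetric TE where
  form _ := flatForm
  symm _ a b := (flatForm_apply a b).trans <| .trans
    (Finset.sum_congr rfl fun i _ ↦ mul_right_comm _ _ _) (flatForm_apply b a).symm
  neutral _ := ⟨(EuclideanSpace.basisFun (Fin 4) ℝ).toBasis, flatForm_basis⟩
  smooth σ τ hσ hτ := contDiff_flatForm ((smoothSection_iff σ).1 hσ) ((smoothSection_iff τ).1 hτ)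

/-- The standard constant frame field of `ℝ^4`. -/
theorem isLocalFrameOn_std : IsLocalFrameOn 𝓘(ℝ, Base 4) Fib ∞ (V := TE)
    (fun (i : Fin 4) (_ : Base 4) ↦ EuclideanSpace.basisFun (Fin 4) ℝ i) univ where
  linearIndependent _ := (EuclideanSpace.basisFun (Fin 4) ℝ).toBasis.linearIndependent
  generating _ := (EuclideanSpace.basisFun (Fin 4) ℝ).toBasis.span_eq.ge
  contMDiffOn _ := ((smoothSection_iff _).2 contDiff_const).contMDiffOn

/-- The standard orientation of `E^4_2`. -/
def flatOrientation : BundleOrientation TE where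
  orient x := (isLocalFrameOn_std.toBasisAt (mem_univ x)).orientation
  locally_constant _ := ⟨univ, isOpen_univ, mem_univ _, _, isLocalFrameOn_std, fun _ _ ↦ rfl⟩

/-- The Levi-Civita connection of `E^4_2`: the derivative of a vector field on `ℝ^4`. -/
def flatConnection : CovariantDerivative 𝓘(ℝ, Base 4) Fib TE where
  toFun (σ : Base 4 → Base 4) x := fderiv ℝ σ x
  isCovariantDerivativeOnUniv :=
    { add := fun hσ hσ' _ ↦
        fderiv_add ((diffSectionAt_iff _ _).1 hσ) ((diffSectionAt_iff _ _).1 hσ')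
      leibniz := fun hσ hg _ ↦ by
        refine (fderiv_smul hg.differentiableAt ((diffSectionAt_iff _ _).1 hσ)).trans ?_
        rw [mvfderiv, mfderiv_eq_fderiv]; rfl }

end FlatSpace

end NeutralRankFour

end

/-!
The splitting `so(2,2) = sl(2) ⊕ sl(2)` turns every part of the theorem into two copies, for
`ε = 1` and `ε = -1`, of a question about flat `sl(2)`-connections.

In a pseudo-orthonormal frame `∇̂ Ω_{ε,2}` only involves the `1`-forms `θ = ω^3_2 + ε ω^4_1` and
`φ = ω^2_1 + ε ω^4_3`, and its square length is `θ² - φ²` (`inducedCov_omegaTwo_eq_twistorDeriv`,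
`inducedForm_twistorDeriv`). Hence `∇̂ Ω_{ε,2}` is fully light-like if and only if `θ² = φ²` and `θ`
vanishes nowhere. Then `φ = ν θ` with a sign `ν` which is constant, as `ℝ^m` is connected. With
`ψ = ω^3_1 - ε ω^4_2` flatness says `dθ = ψ ∧ φ` and `dψ = -θ ∧ φ = 0`; two applications of the
Poincaré lemma give `ψ = df` and `θ = e^{ν f} dg` (`exists_potentials`). The common sign in the
statement is `μ = ν` for `ε = 1`, and the two types are the two possibilities for the sign for
`ε = -1`. This is `isFullyLightLike_iff_hasShape`.

On `E^4_2` it remains to find a global frame adapted to both `J₊` and `J₋`. The two structures lie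
in different summands of `so(2,2)`, so they commute (`commute_of_isAdapted`) and their four joint
eigenspaces are null lines (`trace_jointProj`). A line field on a vector space has a global section
without zeros (`exists_section_ne_zero`), which is obtained by transporting a vector along rays by
successive projections and by gluing over an exhaustion by balls. Sections of the four lines, with
dual ones normalised against each other, combine to the frame (`exists_common_adapted_frame`). Any
pseudo-orthonormal frame adapted to `J₊` has the right orientation and computes `Ω₊`
(`orientation_eq_of_isAdapted`, `omegaTwo_eq_of_isAdapted`), and likewise for `J₋`.

For the converse, `E^4_2` is identified with `ℝ² ⊗ ℝ²`, its metric being the product of two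
determinants. The linear system for a unimodular frame of the plane with the `sl(2)`-connection form
of one factor is solved explicitly (`exists_unimodular_frame`), and the tensor products of two such
frames give the null vectors from which the desired frame is built (`connForm_tensorFrame`,
`exists_frame_of_data`).
-/

set_option linter.unusedSectionVars false

noncomputable section

namespace NeutralRankFour

/-! ### The exterior square -/

theorem update_pair_zero {α : Type*} (a b c : α) : Function.update ![a, b] 0 c = ![c, b] := by
  ext i; fin_cases i <;> rfl

theorem update_pair_one {α : Type*} (a b c : α) : Function.update ![a, b] 1 c = ![a, c] := by
  ext i; fin_cases i <;> rfl

section ExteriorSquare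
variable {W : Type*} [AddCommGroup W] [Module ℝ W]

theorem wedge_add_left (a a' b : W) : wedge (a + a') b = wedge a b + wedge a' b := by
  have h := (exteriorPower.ιMulti ℝ 2 (M := W)).map_update_add ![a, b] 0 a a'
  simp only [update_pair_zero] at h
  exact h

theorem wedge_smul_left (c : ℝ) (a b : W) : wedge (c • a) b = c • wedge a b := by
  have h := (exteriorPower.ιMulti ℝ 2 (M := W)).map_update_smul ![a, b] 0 c a
  simp only [update_pair_zero] at h
  exact h

theorem wedge_self (a : W) : wedge a a = 0 :=
  (exteriorPower.ιMulti ℝ 2 (M := W)).map_eq_zero_of_eq ![a, a] (i := 0) (j := 1) rfl (by decide)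

theorem wedge_add_right (a b b' : W) : wedge a (b + b') = wedge a b + wedge a b' := by
  have h := (exteriorPower.ιMulti ℝ 2 (M := W)).map_update_add ![a, b] 1 b b'
  simp only [update_pair_one] at h
  exact h

theorem wedge_smul_right (c : ℝ) (a b : W) : wedge a (c • b) = c • wedge a b := by
  have h := (exteriorPower.ιMulti ℝ 2 (M := W)).map_update_smul ![a, b] 1 c b
  simp only [update_pair_one] at h
  exact h

theorem wedge_swap (a b : W) : wedge a b = -wedge b a := by
  have h := wedge_self (a + b)
  rw [wedge_add_left, wedge_add_right, wedge_add_right, wedge_self, wedge_self] at h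
  rw [eq_neg_iff_add_eq_zero]
  simpa using h

variable (W) in
/-- The wedge product of two vectors as a bilinear map. -/
def wedgeₗ : W →ₗ[ℝ] W →ₗ[ℝ] ⋀[ℝ]^2 W :=
  LinearMap.mk₂ ℝ wedge wedge_add_left wedge_smul_left wedge_add_right wedge_smul_right

theorem wedgeₗ_apply (a b : W) : wedgeₗ W a b = wedge a b := rfl

theorem wedge_sum_left {ι : Type*} (s : Finset ι) (a : ι → W) (b : W) :
    wedge (∑ i ∈ s, a i) b = ∑ i ∈ s, wedge (a i) b := by
  simp [← wedgeₗ_apply]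

theorem wedge_sum_right {ι : Type*} (s : Finset ι) (a : W) (b : ι → W) :
    wedge a (∑ i ∈ s, b i) = ∑ i ∈ s, wedge a (b i) := by
  simp [← wedgeₗ_apply]

/-- A sum over pairs `i < j` of antisymmetrised coefficients is the sum over all pairs. -/
theorem sum_Ioi_sub_smul {U : Type*} [AddCommGroup U] [Module ℝ U] (c : Fin 4 → Fin 4 → ℝ)
    (F : Fin 4 → Fin 4 → U) (hF : ∀ i j, F i j = -F j i) :
    ∑ i, ∑ j ∈ Finset.Ioi i, (c i j - c j i) • F i j = ∑ i, ∑ j, c i j • F i j := by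
  have hd (i) : F i i = 0 := by
    have h : (2 : ℝ) • F i i = 0 := by rw [two_smul]; exact add_eq_zero_iff_eq_neg.2 (hF i i)
    simpa using h
  have h0 : Finset.Ioi (0 : Fin 4) = {1, 2, 3} := by decide
  have h1 : Finset.Ioi (1 : Fin 4) = {2, 3} := by decide
  have h2 : Finset.Ioi (2 : Fin 4) = {3} := by decide
  have h3 : Finset.Ioi (3 : Fin 4) = ∅ := by decide
  simp only [Fin.sum_univ_four, h0, h1, h2, h3, hd, smul_zero]
  rw [hF 1 0, hF 2 0, hF 3 0, hF 2 1, hF 3 1, hF 3 2]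
  simp
  module

/-- The Leibniz rule for the wedge product, written in coordinates with respect to vectors `S i`
with derivatives `D i`. -/
theorem sum_Ioi_wedge_leibniz (A B dA dB : Fin 4 → ℝ) (S D : Fin 4 → W) :
    ∑ i, ∑ j ∈ Finset.Ioi i,
      ((dA i * B j + A i * dB j - (dA j * B i + A j * dB i)) • wedge (S i) (S j) +
        (A i * B j - A j * B i) • (wedge (D i) (S j) + wedge (S i) (D j))) =
    wedge (∑ i, (dA i • S i + A i • D i)) (∑ j, B j • S j) +
      wedge (∑ i, A i • S i) (∑ j, (dB j • S j + B j • D j)) := by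
  have h1 := sum_Ioi_sub_smul (fun i j ↦ dA i * B j + A i * dB j) (fun i j ↦ wedge (S i) (S j))
    fun i j ↦ wedge_swap _ _
  have h2 := sum_Ioi_sub_smul (fun i j ↦ A i * B j)
    (fun i j ↦ wedge (D i) (S j) + wedge (S i) (D j))
    fun i j ↦ by rw [wedge_swap (D i), wedge_swap (S i)]; abel
  simp only [Finset.sum_add_distrib, h1, h2]
  simp only [← Finset.sum_add_distrib]
  rw [wedge_sum_left, wedge_sum_left, ← Finset.sum_add_distrib]
  refine Finset.sum_congr rfl fun i _ ↦ ?_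
  rw [wedge_sum_right, wedge_sum_right, ← Finset.sum_add_distrib]
  refine Finset.sum_congr rfl fun j _ ↦ ?_
  simp only [wedge_add_left, wedge_smul_left, wedge_smul_right, wedge_add_right]
  module

/-- The value of the derivative of `Ω_{ε,2}`, for the two combinations `θ` and `φ` of the entries of
the connection form on which it depends. -/
def twistorDeriv (ε θ φ : ℝ) (b : Fin 4 → W) : ⋀[ℝ]^2 W :=
  (1 / √2) • (θ • (wedge (b 0) (b 1) + ε • wedge (b 3) (b 2)) +
    φ • (wedge (b 1) (b 2) + ε • wedge (b 0) (b 3)))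

section Orthonormal
variable {h : LinearMap.BilinForm ℝ W} {b : Fin 4 → W}
  (hb : ∀ i j, h (b i) (b j) = if i = j then sgn i else 0)
include hb

theorem inducedForm_twistorDeriv {ε : ℝ} (hε : ε ^ 2 = 1) (θ φ : ℝ) :
    inducedForm h (twistorDeriv ε θ φ b) (twistorDeriv ε θ φ b) = θ ^ 2 - φ ^ 2 := by
  have h2 : (√2)⁻¹ * (√2)⁻¹ = (1 / 2 : ℝ) := by
    rw [← mul_inv, Real.mul_self_sqrt (by norm_num)]; norm_num
  simp [twistorDeriv, inducedForm_wedge, hb, sgn]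
  linear_combination (2 * θ ^ 2 - 2 * φ ^ 2) * h2 +
    (√2)⁻¹ * (√2)⁻¹ * (θ ^ 2 - φ ^ 2) * hε

theorem twistorDeriv_ne_zero {ε θ : ℝ} (φ : ℝ) (hθ : θ ≠ 0) : twistorDeriv ε θ φ b ≠ 0 := by
  intro h0
  have h1 : inducedForm h (twistorDeriv ε θ φ b) (wedge (b 0) (b 1)) = 0 := by simp [h0]
  simp [twistorDeriv, inducedForm_wedge, hb, sgn] at h1
  exact hθ h1

end Orthonormal

end ExteriorSquare

/-! ### The induced connection on bivectors -/

section InducedConnection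

variable {m : ℕ} {V : Base m → Type*} [TopologicalSpace (TotalSpace Fib V)]
  [∀ x, AddCommGroup (V x)] [∀ x, Module ℝ (V x)] [∀ x, TopologicalSpace (V x)]
  [FiberBundle Fib V]

theorem SmoothSection.diffSectionAt {σ : Π x, V x} (hσ : SmoothSection σ) (x : Base m) :
    DiffSectionAt σ x :=
  (hσ.mdifferentiable (by simp)) x

theorem wedgeCoeff_add {s : Fin 4 → Π x, V x} {u : Set (Base m)}
    (hs : IsLocalFrameOn 𝓘(ℝ, Base m) Fib ∞ s u) (i j : Fin 4) (Ω Ω' : ∀ x, ⋀[ℝ]^2 (V x)) :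
    wedgeCoeff hs i j (fun y ↦ Ω y + Ω' y) =
      fun y ↦ wedgeCoeff hs i j Ω y + wedgeCoeff hs i j Ω' y :=
  funext fun _ ↦ map_add _ _ _

theorem wedgeCoeff_const_smul {s : Fin 4 → Π x, V x} {u : Set (Base m)}
    (hs : IsLocalFrameOn 𝓘(ℝ, Base m) Fib ∞ s u) (i j : Fin 4) (c : ℝ)
    (Ω : ∀ x, ⋀[ℝ]^2 (V x)) :
    wedgeCoeff hs i j (fun y ↦ c • Ω y) = fun y ↦ c * wedgeCoeff hs i j Ω y :=
  funext fun _ ↦ map_smul _ _ _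

theorem wedgeCoeff_wedge {s : Fin 4 → Π x, V x} {u : Set (Base m)}
    (hs : IsLocalFrameOn 𝓘(ℝ, Base m) Fib ∞ s u) (i j : Fin 4) (σ τ : Π x, V x) :
    wedgeCoeff hs i j (fun y ↦ wedge (σ y) (τ y)) = fun y ↦
      hs.coeff i y (σ y) * hs.coeff j y (τ y) - hs.coeff j y (σ y) * hs.coeff i y (τ y) := by
  funext y
  simp only [wedgeCoeff, wedge]
  rw [exteriorPower.pairingDual_ιMulti_ιMulti]
  simp [Matrix.det_fin_two]

variable [VectorBundle ℝ Fib V] [ContMDiffVectorBundle ∞ Fib V 𝓘(ℝ, Base m)]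

theorem DiffSectionAt.differentiableAt_coeff {σ : Π x, V x} {x : Base m} (hσ : DiffSectionAt σ x)
    (i : Fin 4) : DifferentiableAt ℝ
      (fun y ↦ ((trivializationAt Fib V x).isLocalFrameOn_localFrame_baseSet 𝓘(ℝ, Base m) ∞
        (EuclideanSpace.basisFun (Fin 4) ℝ).toBasis).coeff i y (σ y)) x := by
  have : ContMDiffVectorBundle 1 Fib V 𝓘(ℝ, Base m) := .of_le (n := ∞) (by simp)
  have h := mdifferentiableAt_localFrameCoeff (I := 𝓘(ℝ, Base m))
    (e := trivializationAt Fib V x) (EuclideanSpace.basisFun (Fin 4) ℝ).toBasis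
    (FiberBundle.mem_baseSet_trivializationAt' x) hσ i
  exact mdifferentiableAt_iff_differentiableAt.1 h

variable [∀ x, IsTopologicalAddGroup (V x)] [∀ x, ContinuousSMul ℝ (V x)]
  (cov : CovariantDerivative 𝓘(ℝ, Base m) Fib V)

theorem cov_smul {g : Base m → ℝ} {σ : Π x, V x} {x : Base m} (hg : DifferentiableAt ℝ g x)
    (hσ : DiffSectionAt σ x) (X : Base m) :
    cov (fun y ↦ g y • σ y) x X = fderiv ℝ g x X • σ x + g x • cov σ x X := by
  have h := congr($(cov.isCovariantDerivativeOnUniv.leibniz hσ hg.mdifferentiableAt) X)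
  refine h.trans ?_
  rw [mvfderiv, mfderiv_eq_fderiv]
  exact add_comm _ _

theorem DiffSectionAt.smul {g : Base m → ℝ} {σ : Π x, V x} {x : Base m}
    (hg : DifferentiableAt ℝ g x) (hσ : DiffSectionAt σ x) :
    DiffSectionAt (fun y ↦ g y • σ y) x :=
  MDifferentiableAt.smul_section hg.mdifferentiableAt hσ

theorem DiffSectionAt.sum {ι : Type*} {s : Finset ι} {σ : ι → Π x, V x} {x : Base m}
    (hσ : ∀ i ∈ s, DiffSectionAt (σ i) x) : DiffSectionAt (fun y ↦ ∑ i ∈ s, σ i y) x :=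
  MDifferentiableAt.sum_section hσ

theorem cov_sum {ι : Type*} (s : Finset ι) {σ : ι → Π x, V x} {x : Base m}
    (hσ : ∀ i ∈ s, DiffSectionAt (σ i) x) :
    cov (fun y ↦ ∑ i ∈ s, σ i y) x = ∑ i ∈ s, cov (σ i) x := by
  classical
  induction s using Finset.induction_on with
  | empty => exact congrFun (CovariantDerivative.zero cov) x
  | insert a s ha ih =>
    simp only [Finset.sum_insert ha]
    rw [← ih fun i hi ↦ hσ i (Finset.mem_insert_of_mem hi)]
    exact cov.isCovariantDerivativeOnUniv.add (hσ a (Finset.mem_insert_self a s))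
      (DiffSectionAt.sum fun i hi ↦ hσ i (Finset.mem_insert_of_mem hi))

/-- The covariant derivative in coordinates: if `σ = ∑ i, c i • s i` near `x`, then
`∇ σ = ∑ i, (d(c i) • s i + c i • ∇ (s i))` at `x`. -/
theorem cov_eq_sum {σ : Π x, V x} {c : Fin 4 → Base m → ℝ} {s : Fin 4 → Π x, V x} {x : Base m}
    (hσ : DiffSectionAt σ x) (hc : ∀ i, DifferentiableAt ℝ (c i) x)
    (hs : ∀ i, DiffSectionAt (s i) x) (heq : ∀ᶠ y in nhds x, σ y = ∑ i, c i y • s i y)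
    (X : Base m) :
    cov σ x X = ∑ i, (fderiv ℝ (c i) x X • s i x + c i x • cov (s i) x X) := by
  have hd : ∀ i ∈ Finset.univ, DiffSectionAt (fun y ↦ c i y • s i y) x :=
    fun i _ ↦ (hs i).smul (hc i)
  rw [cov.isCovariantDerivativeOnUniv.congr_of_eventuallyEq hσ (DiffSectionAt.sum hd)
    Filter.univ_mem heq, cov_sum cov _ hd]
  exact (_root_.sum_apply _ _ _).trans
    (Finset.sum_congr rfl fun i _ ↦ cov_smul cov (hc i) (hs i) X)

/-- The Leibniz rule `∇̂ (σ ∧ τ) = ∇ σ ∧ τ + σ ∧ ∇ τ`, which characterises the induced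
connection. -/
theorem inducedCov_wedge {σ τ : Π x, V x} {x : Base m} (hσ : DiffSectionAt σ x)
    (hτ : DiffSectionAt τ x) (X : Base m) :
    inducedCov cov (fun y ↦ wedge (σ y) (τ y)) x X =
      wedge (cov σ x X) (τ x) + wedge (σ x) (cov τ x X) := by
  let s := (trivializationAt Fib V x).localFrame (EuclideanSpace.basisFun (Fin 4) ℝ).toBasis
  have hs : IsLocalFrameOn 𝓘(ℝ, Base m) Fib ∞ s (trivializationAt Fib V x).baseSet :=
    (trivializationAt Fib V x).isLocalFrameOn_localFrame_baseSet 𝓘(ℝ, Base m) ∞ _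
  have hx : x ∈ (trivializationAt Fib V x).baseSet := FiberBundle.mem_baseSet_trivializationAt' x
  have hu := (trivializationAt Fib V x).open_baseSet.mem_nhds hx
  have hsd (i) : DiffSectionAt (s i) x :=
    (hs.contMDiffAt (trivializationAt Fib V x).open_baseSet hx i).mdifferentiableAt (by simp)
  have hA (i) : DifferentiableAt ℝ (fun y ↦ hs.coeff i y (σ y)) x := hσ.differentiableAt_coeff i
  have hB (i) : DifferentiableAt ℝ (fun y ↦ hs.coeff i y (τ y)) x := hτ.differentiableAt_coeff i
  have key := sum_Ioi_wedge_leibniz (fun i ↦ hs.coeff i x (σ x)) (fun i ↦ hs.coeff i x (τ x))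
    (fun i ↦ fderiv ℝ (fun y ↦ hs.coeff i y (σ y)) x X)
    (fun i ↦ fderiv ℝ (fun y ↦ hs.coeff i y (τ y)) x X) (fun i ↦ s i x) (fun i ↦ cov (s i) x X)
  rw [← cov_eq_sum cov hσ hA hsd (hs.eventually_eq_sum_coeff_smul σ hu),
    ← cov_eq_sum cov hτ hB hsd (hs.eventually_eq_sum_coeff_smul τ hu),
    ← hs.coeff_sum_eq σ hx, ← hs.coeff_sum_eq τ hx] at key
  rw [← key]
  change ∑ i, ∑ j ∈ Finset.Ioi i,
    (fderiv ℝ (wedgeCoeff hs i j fun y ↦ wedge (σ y) (τ y)) x X • wedge (s i x) (s j x) +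
      wedgeCoeff hs i j (fun y ↦ wedge (σ y) (τ y)) x •
        (wedge (cov (s i) x X) (s j x) + wedge (s i x) (cov (s j) x X))) = _
  refine Finset.sum_congr rfl fun i _ ↦ Finset.sum_congr rfl fun j _ ↦ ?_
  rw [wedgeCoeff_wedge]
  congr 2
  rw [fderiv_fun_sub ((hA i).fun_mul (hB j)) ((hA j).fun_mul (hB i)), fderiv_fun_mul (hA i) (hB j),
    fderiv_fun_mul (hA j) (hB i)]
  simp
  ring

/-- A bivector field is differentiable at `x`: its coefficients with respect to the preferred local
trivialisation at `x` are. -/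
def DiffBivectorAt (Ω : ∀ x, ⋀[ℝ]^2 (V x)) (x : Base m) : Prop :=
  ∀ i j, DifferentiableAt ℝ (wedgeCoeff
    ((trivializationAt Fib V x).isLocalFrameOn_localFrame_baseSet 𝓘(ℝ, Base m) ∞
      (EuclideanSpace.basisFun (Fin 4) ℝ).toBasis) i j Ω) x

theorem DiffSectionAt.wedge {σ τ : Π x, V x} {x : Base m} (hσ : DiffSectionAt σ x)
    (hτ : DiffSectionAt τ x) : DiffBivectorAt (fun y ↦ wedge (σ y) (τ y)) x := fun i j ↦ by
  rw [wedgeCoeff_wedge]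
  exact ((hσ.differentiableAt_coeff i).fun_mul (hτ.differentiableAt_coeff j)).fun_sub
    ((hσ.differentiableAt_coeff j).fun_mul (hτ.differentiableAt_coeff i))

theorem DiffBivectorAt.add {Ω Ω' : ∀ x, ⋀[ℝ]^2 (V x)} {x : Base m} (hΩ : DiffBivectorAt Ω x)
    (hΩ' : DiffBivectorAt Ω' x) : DiffBivectorAt (fun y ↦ Ω y + Ω' y) x := fun i j ↦ by
  rw [wedgeCoeff_add]
  exact (hΩ i j).fun_add (hΩ' i j)

theorem DiffBivectorAt.const_smul {Ω : ∀ x, ⋀[ℝ]^2 (V x)} {x : Base m} (c : ℝ)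
    (hΩ : DiffBivectorAt Ω x) : DiffBivectorAt (fun y ↦ c • Ω y) x := fun i j ↦ by
  rw [wedgeCoeff_const_smul]
  exact (hΩ i j).const_mul c

theorem inducedCov_add {Ω Ω' : ∀ x, ⋀[ℝ]^2 (V x)} {x : Base m} (hΩ : DiffBivectorAt Ω x)
    (hΩ' : DiffBivectorAt Ω' x) (X : Base m) :
    inducedCov cov (fun y ↦ Ω y + Ω' y) x X = inducedCov cov Ω x X + inducedCov cov Ω' x X := by
  simp only [inducedCov, ← Finset.sum_add_distrib]
  refine Finset.sum_congr rfl fun i _ ↦ Finset.sum_congr rfl fun j _ ↦ ?_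
  rw [wedgeCoeff_add, fderiv_fun_add (hΩ i j) (hΩ' i j), add_apply]
  module

theorem inducedCov_const_smul {Ω : ∀ x, ⋀[ℝ]^2 (V x)} {x : Base m} (c : ℝ)
    (hΩ : DiffBivectorAt Ω x) (X : Base m) :
    inducedCov cov (fun y ↦ c • Ω y) x X = c • inducedCov cov Ω x X := by
  simp only [inducedCov, Finset.smul_sum]
  refine Finset.sum_congr rfl fun i _ ↦ Finset.sum_congr rfl fun j _ ↦ ?_
  rw [wedgeCoeff_const_smul, fderiv_const_mul (hΩ i j) c, smul_apply]
  simp only [smul_eq_mul]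
  module

theorem inducedCov_omegaTwo {e : Fin 4 → Π x, V x} {x : Base m} (he : ∀ i, DiffSectionAt (e i) x)
    (ε : ℝ) (X : Base m) :
    inducedCov cov (fun y ↦ omegaTwo ε (fun i ↦ e i y)) x X =
      (1 / √2) • (wedge (cov (e 0) x X) (e 2 x) + wedge (e 0 x) (cov (e 2) x X) +
        ε • (wedge (cov (e 3) x X) (e 1 x) + wedge (e 3 x) (cov (e 1) x X))) := by
  have h1 := (he 0).wedge (he 2)
  have h2 := ((he 3).wedge (he 1)).const_smul ε
  simp only [omegaTwo]
  rw [inducedCov_const_smul cov _ (h1.add h2), inducedCov_add cov h1 h2,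
    inducedCov_const_smul cov _ ((he 3).wedge (he 1)), inducedCov_wedge cov (he 0) (he 2),
    inducedCov_wedge cov (he 3) (he 1)]

end InducedConnection

/-! ### The connection form of a frame field -/

section ConnectionForm

variable {m : ℕ} {V : Base m → Type*} [TopologicalSpace (TotalSpace Fib V)]
  [∀ x, AddCommGroup (V x)] [∀ x, Module ℝ (V x)] [∀ x, TopologicalSpace (V x)]
  [FiberBundle Fib V] [∀ x, IsTopologicalAddGroup (V x)] [∀ x, ContinuousSMul ℝ (V x)]
  {cov : CovariantDerivative 𝓘(ℝ, Base m) Fib V}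
  {e : Fin 4 → Π x, V x} (he : IsLocalFrameOn 𝓘(ℝ, Base m) Fib ∞ e univ)

theorem sgn_mul_self (i : Fin 4) : sgn i * sgn i = 1 := by
  fin_cases i <;> simp [sgn]

include he in
theorem IsLocalFrameOn.smoothSection (i : Fin 4) : SmoothSection (e i) :=
  contMDiffOn_univ.1 (he.contMDiffOn i)

theorem cov_eq_sum_connForm (j : Fin 4) (x X : Base m) :
    cov (e j) x X = ∑ i, connForm cov he i j x X • e i x :=
  he.coeff_sum_eq (fun y ↦ cov (e j) y X) (mem_univ x)

/-- The entry `ω^i_j` of the connection form, as a `1`-form. -/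
def connOneForm (cov : CovariantDerivative 𝓘(ℝ, Base m) Fib V)
    (he : IsLocalFrameOn 𝓘(ℝ, Base m) Fib ∞ e univ) (i j : Fin 4) (x : Base m) : Base m →L[ℝ] ℝ :=
  LinearMap.toContinuousLinearMap
    { toFun := fun X ↦ connForm cov he i j x X
      map_add' := fun X Y ↦ (congrArg (he.coeff i x) (map_add (cov (e j) x) X Y)).trans
        (map_add _ _ _)
      map_smul' := fun c X ↦ (congrArg (he.coeff i x) (map_smul (cov (e j) x) c X)).trans
        (map_smul _ _ _) }

theorem connOneForm_apply (i j : Fin 4) (x X : Base m) :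
    connOneForm cov he i j x X = connForm cov he i j x X := rfl

section Orthonormal

variable {h : NeutralMetric V}
  (hon : ∀ x i j, h.form x (e i x) (e j x) = if i = j then sgn i else 0)
include hon

theorem coeff_eq_form (i : Fin 4) (x : Base m) (v : V x) :
    he.coeff i x v = sgn i * h.form x (e i x) v := by
  classical
  obtain ⟨t, rfl⟩ : ∃ t : Π x, V x, t x = v := ⟨Function.update 0 x v, by simp⟩
  conv_rhs => rw [he.coeff_sum_eq t (mem_univ x)]
  simp only [map_sum, map_smul, hon, smul_eq_mul]
  simp only [mul_ite, mul_zero, Finset.sum_ite_eq, Finset.mem_univ, if_true]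
  linear_combination -(he.coeff i x (t x)) * sgn_mul_self i

theorem connForm_eq_form (i j : Fin 4) (x X : Base m) :
    connForm cov he i j x X = sgn i * h.form x (e i x) (cov (e j) x X) :=
  coeff_eq_form he hon i x _

/-- The connection form of a metric connection in a pseudo-orthonormal frame has values in
`so(2,2)`. -/
theorem connForm_skew (hcov : IsMetricConnection h cov) (i j : Fin 4) (x X : Base m) :
    connForm cov he j i x X = -(sgn i * sgn j) * connForm cov he i j x X := by
  have hd (i) := (IsLocalFrameOn.smoothSection he i).diffSectionAt x
  have h1 := hcov (e i) (e j) x (hd i) (hd j) X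
  have h2 : (fun y ↦ h.form y (e i y) (e j y)) = fun _ ↦ if i = j then sgn i else 0 :=
    funext fun y ↦ hon y i j
  rw [h2, h.symm x (cov (e i) x X)] at h1
  simp only [fderiv_fun_const, Pi.zero_apply, zero_apply] at h1
  rw [connForm_eq_form he hon, connForm_eq_form he hon]
  linear_combination (-sgn j) * h1 + sgn j * h.form x (e i x) (cov (e j) x X) * sgn_mul_self i

theorem contDiff_connOneForm (hsm : ∀ j (X : Base m), SmoothSection fun x ↦ cov (e j) x X)
    (i j : Fin 4) :
    ContDiff ℝ ∞ (connOneForm cov he i j) := by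
  refine contDiff_clm_apply_iff.2 fun X ↦ ?_
  simp only [connOneForm_apply, connForm_eq_form he hon]
  exact contDiff_const.mul
    (h.smooth _ _ (IsLocalFrameOn.smoothSection he i) (hsm j X))

end Orthonormal

/-- The structure equation `dω^k_j = - ∑ i, ω^k_i ∧ ω^i_j` of a flat connection. -/
theorem fderiv_connOneForm_sub (hflat : IsFlatConnection cov)
    [VectorBundle ℝ Fib V] [ContMDiffVectorBundle ∞ Fib V 𝓘(ℝ, Base m)]
    (hsm : ∀ j (X : Base m), SmoothSection fun x ↦ cov (e j) x X)
    (hω : ∀ i j, ContDiff ℝ ∞ (connOneForm cov he i j)) (k j : Fin 4) (x X Y : Base m) :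
    fderiv ℝ (connOneForm cov he k j) x X Y - fderiv ℝ (connOneForm cov he k j) x Y X =
      -∑ i, (connOneForm cov he k i x X * connOneForm cov he i j x Y -
        connOneForm cov he k i x Y * connOneForm cov he i j x X) := by
  have hd (i) := (IsLocalFrameOn.smoothSection he i).diffSectionAt x
  have hωd (i j) : DifferentiableAt ℝ (connOneForm cov he i j) x :=
    (hω i j).differentiable (by simp) x
  have key (X Y : Base m) : he.coeff k x (cov (fun y ↦ cov (e j) y Y) x X) =
      fderiv ℝ (connOneForm cov he k j) x X Y +
        ∑ i, connOneForm cov he k i x X * connOneForm cov he i j x Y := by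
    have h1 := cov_eq_sum cov (σ := fun y ↦ cov (e j) y Y)
      (c := fun i y ↦ connOneForm cov he i j y Y) (s := e) ((hsm j Y).diffSectionAt x)
      (fun i ↦ (hωd i j).clm_apply (differentiableAt_const _)) hd
      (Filter.Eventually.of_forall fun y ↦ cov_eq_sum_connForm he j y Y) X
    rw [h1]
    have h2 (i) : he.coeff k x (e i x) = if i = k then 1 else 0 := by
      have h := (he.toBasisAt (mem_univ x)).repr_self_apply i k
      rw [he.toBasisAt_coe] at h
      exact (he.coeff_apply_of_mem (mem_univ x) (e i) k).trans h
    have h3 (i) : fderiv ℝ (fun y ↦ connOneForm cov he i j y Y) x X =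
        fderiv ℝ (connOneForm cov he i j) x X Y := by
      rw [fderiv_clm_apply (hωd i j) (differentiableAt_const _)]
      simp
    have h4 (i) : he.coeff k x (cov (e i) x X) = connOneForm cov he k i x X := rfl
    simp only [map_sum, map_add, map_smul, h2, h3, h4, smul_eq_mul, Finset.sum_add_distrib]
    simp [mul_comm]
  have h0 := hflat (fun _ ↦ X) (fun _ ↦ Y) (e j) contDiff_const contDiff_const
    (IsLocalFrameOn.smoothSection he j) x
  have hlie : VectorField.lieBracket ℝ (fun _ ↦ X) (fun _ ↦ Y) x = 0 := by
    simp [VectorField.lieBracket]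
  have h6 : he.coeff k x (cov (e j) x (VectorField.lieBracket ℝ (fun _ ↦ X) (fun _ ↦ Y) x)) = 0 :=
    (congrArg (fun Z ↦ he.coeff k x (cov (e j) x Z)) hlie).trans
      ((congrArg (he.coeff k x) (map_zero (cov (e j) x))).trans (map_zero _))
  have h5 := congrArg (he.coeff k x) h0
  rw [map_sub, map_sub, map_zero] at h5
  have h7 := (congrArg₂ (· - ·) (congrArg₂ (· - ·) (key X Y) (key Y X)) h6).symm.trans h5
  rw [Finset.sum_sub_distrib]
  linarith

theorem smoothSection_cov [VectorBundle ℝ Fib V] [ContMDiffVectorBundle ∞ Fib V 𝓘(ℝ, Base m)]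
    (hcov : cov.ContMDiffCovariantDerivative ∞) {σ : Π x, V x} (hσ : SmoothSection σ)
    (X : Base m) : SmoothSection fun x ↦ cov σ x X := by
  have h1 := contMDiffOn_univ.1 (hcov.contMDiff.contMDiff (σ := σ) (contMDiffOn_univ.2 hσ))
  have h2 : ContMDiff 𝓘(ℝ, Base m) (𝓘(ℝ, Base m).prod 𝓘(ℝ, Base m)) ∞
      (fun x ↦ TotalSpace.mk' (Base m) (E := TangentSpace 𝓘(ℝ, Base m)) x X) :=
    fun x ↦ contMDiffAt_vectorSpace_iff_contDiffAt.2 contDiffAt_const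
  exact h1.clm_bundle_apply h2

end ConnectionForm

/-! ### Potentials of the connection form and the light-like condition -/

section Potentials

variable {E : Type*} [NormedAddCommGroup E] [NormedSpace ℝ E]

theorem eq_or_eq_neg_of_sq_apply_eq {θ φ : E →L[ℝ] ℝ} (h : ∀ X, θ X ^ 2 = φ X ^ 2) :
    φ = θ ∨ φ = -θ := by
  by_contra! hne
  obtain ⟨X, hX⟩ := DFunLike.ne_iff.1 hne.1
  obtain ⟨Y, hY⟩ := DFunLike.ne_iff.1 hne.2
  have key (Z : E) : φ Z = θ Z ∨ φ Z = -θ Z := sq_eq_sq_iff_eq_or_eq_neg.1 (h Z).symm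
  have hX' := (key X).resolve_left hX
  have hY' := (key Y).resolve_right hY
  rcases key (X + Y) with h1 | h1 <;> simp only [map_add] at h1
  · exact hX (by linarith)
  · exact hY (by simp only [neg_apply]; linarith)

/-- By connectedness, the sign in `φ = ± θ` is constant when `θ` vanishes nowhere. -/
theorem exists_sign_of_sq_apply_eq {θ φ : E → E →L[ℝ] ℝ} (hθ : Continuous θ) (hφ : Continuous φ)
    (hsq : ∀ x X, θ x X ^ 2 = φ x X ^ 2) (hne : ∀ x, θ x ≠ 0) :
    ∃ ν : ℝ, (ν = 1 ∨ ν = -1) ∧ ∀ x, φ x = ν • θ x := by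
  have hcl : IsClosed {x | φ x = θ x} := isClosed_eq hφ hθ
  have hcl' : IsClosed {x | φ x = -θ x} := isClosed_eq hφ hθ.neg
  have hcompl : {x | φ x = θ x}ᶜ = {x | φ x = -θ x} := by
    ext x
    refine ⟨fun h ↦ (eq_or_eq_neg_of_sq_apply_eq (hsq x)).resolve_left h, fun h h' ↦ ?_⟩
    refine hne x (ContinuousLinearMap.ext fun X ↦ ?_)
    have := DFunLike.congr_fun (h'.symm.trans h) X
    exact self_eq_neg.1 this
  have hclopen : IsClopen {x | φ x = θ x} := ⟨hcl, by rw [← isClosed_compl_iff, hcompl]; exact hcl'⟩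
  rcases isClopen_iff.1 hclopen with h | h
  · refine ⟨-1, Or.inr rfl, fun x ↦ ?_⟩
    rw [h, compl_empty] at hcompl
    exact (hcompl.subset (mem_univ x)).trans (neg_one_smul ℝ _).symm
  · exact ⟨1, Or.inl rfl, fun x ↦ by rw [one_smul]; exact h.superset (mem_univ x)⟩

/-- The Poincaré lemma for smooth closed `1`-forms on a vector space. -/
theorem exists_contDiff_potential {η : E → E →L[ℝ] ℝ} (hη : ContDiff ℝ ∞ η)
    (hd : ∀ x X Y, fderiv ℝ η x X Y = fderiv ℝ η x Y X) :
    ∃ f : E → ℝ, ContDiff ℝ ∞ f ∧ ∀ x, fderiv ℝ f x = η x := by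
  obtain ⟨f, hf⟩ := convex_univ.exists_forall_hasFDerivAt_of_fderiv_symmetric isOpen_univ
    (hη.differentiable (by simp)).differentiableOn fun x _ ↦ hd x
  have hfd (x) : fderiv ℝ f x = η x := (hf x (mem_univ x)).fderiv
  refine ⟨f, contDiff_infty_iff_fderiv.2 ⟨fun x ↦ (hf x (mem_univ x)).differentiableAt, ?_⟩, hfd⟩
  rwa [funext hfd]

/-- Let `θ, φ, ψ` be `1`-forms with `dθ = ψ ∧ φ` and `dψ = - θ ∧ φ`, such that `θ` vanishes nowhere
and `θ² = φ²`. Then `φ = ν θ` for a constant sign `ν`, so that `ψ` is closed and `θ` is closed up to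
an integrating factor. -/
theorem exists_potentials {θ φ ψ : E → E →L[ℝ] ℝ} (hθ : ContDiff ℝ ∞ θ) (hφ : ContDiff ℝ ∞ φ)
    (hψ : ContDiff ℝ ∞ ψ)
    (hdθ : ∀ x X Y, fderiv ℝ θ x X Y - fderiv ℝ θ x Y X = ψ x X * φ x Y - ψ x Y * φ x X)
    (hdψ : ∀ x X Y, fderiv ℝ ψ x X Y - fderiv ℝ ψ x Y X = -(θ x X * φ x Y - θ x Y * φ x X))
    (hsq : ∀ x X, θ x X ^ 2 = φ x X ^ 2) (hne : ∀ x, θ x ≠ 0) :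
    ∃ (ν : ℝ) (f g : E → ℝ), (ν = 1 ∨ ν = -1) ∧ ContDiff ℝ ∞ f ∧ ContDiff ℝ ∞ g ∧
      (∀ x, fderiv ℝ g x ≠ 0) ∧ (∀ x, fderiv ℝ f x = ψ x) ∧
      (∀ x X, θ x X = Real.exp (ν * f x) * fderiv ℝ g x X) ∧ ∀ x X, φ x X = ν * θ x X := by
  obtain ⟨ν, hν, hφθ⟩ := exists_sign_of_sq_apply_eq hθ.continuous hφ.continuous hsq hne
  have hφ' (x X) : φ x X = ν * θ x X := by simp [hφθ]
  obtain ⟨f, hf, hdf⟩ := exists_contDiff_potential hψ fun x X Y ↦ by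
    have := hdψ x X Y
    rw [hφ', hφ'] at this
    linarith
  have hE : ContDiff ℝ ∞ fun x ↦ Real.exp (-(ν * f x)) := (contDiff_const.mul hf).neg.exp
  obtain ⟨g, hg, hdg⟩ := exists_contDiff_potential (hE.smul hθ) fun x X Y ↦ by
    have hfx : DifferentiableAt ℝ f x := hf.differentiable (by simp) x
    have hθx : DifferentiableAt ℝ θ x := hθ.differentiable (by simp) x
    have hEx : HasFDerivAt (fun x ↦ Real.exp (-(ν * f x)))
        (Real.exp (-(ν * f x)) • -(ν • fderiv ℝ f x)) x :=
      ((hfx.hasFDerivAt.const_mul ν).neg).exp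
    rw [(hEx.smul hθx.hasFDerivAt).fderiv]
    have := hdθ x X Y
    rw [hφ', hφ'] at this
    simp [hdf]
    linear_combination Real.exp (-(ν * f x)) * this
  have hexp (x) : Real.exp (ν * f x) * Real.exp (-(ν * f x)) = 1 := by
    rw [← Real.exp_add]; simp
  refine ⟨ν, f, g, hν, hf, hg, fun x h ↦ hne x ?_, hdf, fun x X ↦ ?_, hφ'⟩
  · rw [hdg] at h
    exact (smul_eq_zero.1 h).resolve_left (Real.exp_pos _).ne'
  · rw [hdg, Pi.smul_apply', smul_apply, smul_eq_mul]
    linear_combination (-θ x X) * hexp x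

end Potentials

section Criterion

variable {m : ℕ} {V : Base m → Type*} [TopologicalSpace (TotalSpace Fib V)]
  [∀ x, AddCommGroup (V x)] [∀ x, Module ℝ (V x)] [∀ x, TopologicalSpace (V x)]
  [FiberBundle Fib V] [∀ x, IsTopologicalAddGroup (V x)] [∀ x, ContinuousSMul ℝ (V x)]
  [VectorBundle ℝ Fib V] [ContMDiffVectorBundle ∞ Fib V 𝓘(ℝ, Base m)]
  {cov : CovariantDerivative 𝓘(ℝ, Base m) Fib V} {h : NeutralMetric V}
  {e : Fin 4 → Π x, V x} (he : IsLocalFrameOn 𝓘(ℝ, Base m) Fib ∞ e univ)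
  (hon : ∀ x i j, h.form x (e i x) (e j x) = if i = j then sgn i else 0)
  (hcov : IsMetricConnection h cov)
include hon hcov

theorem connForm_skew_components (x X : Base m) :
    connForm cov he 0 0 x X = 0 ∧ connForm cov he 1 1 x X = 0 ∧ connForm cov he 2 2 x X = 0 ∧
    connForm cov he 3 3 x X = 0 ∧
    connForm cov he 0 1 x X = -connForm cov he 1 0 x X ∧
    connForm cov he 0 2 x X = connForm cov he 2 0 x X ∧
    connForm cov he 0 3 x X = connForm cov he 3 0 x X ∧
    connForm cov he 1 2 x X = connForm cov he 2 1 x X ∧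
    connForm cov he 1 3 x X = connForm cov he 3 1 x X ∧
    connForm cov he 2 3 x X = -connForm cov he 3 2 x X := by
  have hs (i j) := connForm_skew he hon hcov i j x X
  have hd (i) : connForm cov he i i x X = 0 := by
    have := hs i i
    rw [sgn_mul_self] at this
    linarith
  refine ⟨hd 0, hd 1, hd 2, hd 3, ?_, ?_, ?_, ?_, ?_, ?_⟩
  · simpa [sgn] using hs 1 0
  · simpa [sgn] using hs 2 0
  · simpa [sgn] using hs 3 0
  · simpa [sgn] using hs 2 1
  · simpa [sgn] using hs 3 1
  · simpa [sgn] using hs 3 2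

/-- Of the six `1`-forms `ω^i_j`, only the combinations `θ = ω^3_2 + ε ω^4_1` and
`φ = ω^2_1 + ε ω^4_3` enter into `∇̂ Ω_{ε,2}`. -/
theorem inducedCov_omegaTwo_eq_twistorDeriv {ε : ℝ} (hε : ε ^ 2 = 1) (x X : Base m) :
    inducedCov cov (fun y ↦ omegaTwo ε (fun i ↦ e i y)) x X =
      twistorDeriv ε (connForm cov he 2 1 x X + ε * connForm cov he 3 0 x X)
        (connForm cov he 1 0 x X + ε * connForm cov he 3 2 x X) (fun i ↦ e i x) := by
  obtain ⟨h00, h11, h22, h33, h01, h02, h03, h12, h13, h23⟩ :=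
    connForm_skew_components he hon hcov x X
  rw [inducedCov_omegaTwo cov
    (fun i ↦ (IsLocalFrameOn.smoothSection he i).diffSectionAt x)]
  simp only [cov_eq_sum_connForm he, Fin.sum_univ_four, wedge_add_left, wedge_add_right,
    wedge_smul_left, wedge_smul_right, wedge_self, twistorDeriv, h00, h11, h22, h33, h01, h02, h03,
    h12, h13, h23]
  rw [wedge_swap (e 2 x) (e 1 x), wedge_swap (e 3 x) (e 0 x)]
  congr 1
  rcases sq_eq_one_iff.1 hε with rfl | rfl <;> module

/-- `∇̂ Ω_{ε,2}` is fully light-like exactly if `θ² = φ²` and `θ` vanishes nowhere. -/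
theorem isFullyLightLike_omegaTwo_iff {ε : ℝ} (hε : ε ^ 2 = 1) :
    IsFullyLightLike h cov (fun x ↦ omegaTwo ε (fun i ↦ e i x)) ↔
      ∀ x, (∀ X, (connForm cov he 2 1 x X + ε * connForm cov he 3 0 x X) ^ 2 =
          (connForm cov he 1 0 x X + ε * connForm cov he 3 2 x X) ^ 2) ∧
        ∃ X, connForm cov he 2 1 x X + ε * connForm cov he 3 0 x X ≠ 0 := by
  refine forall_congr' fun x ↦ ?_
  simp only [inducedCov_omegaTwo_eq_twistorDeriv he hon hcov hε,
    inducedForm_twistorDeriv (hon x) hε, sub_eq_zero]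
  refine and_congr_right fun hsq ↦ exists_congr fun X ↦ ⟨fun hne hθ ↦ hne ?_, fun hθ ↦
    twistorDeriv_ne_zero (hon x) _ hθ⟩
  have hφ := hsq X
  rw [hθ, zero_pow two_ne_zero] at hφ
  rw [hθ, pow_eq_zero_iff two_ne_zero |>.1 hφ.symm]
  simp [twistorDeriv]

theorem isFullyLightLike_of_hasShape (hΓ : HasShape (connForm cov he)) :
    IsFullyLightLike h cov (fun x ↦ omegaTwo 1 (fun i ↦ e i x)) ∧
      IsFullyLightLike h cov (fun x ↦ omegaTwo (-1) (fun i ↦ e i x)) := by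
  obtain ⟨μ, fp, fm, gp, gm, hμ, ⟨-, -, -, -, hgp, hgm⟩, -, hΓ⟩ := hΓ
  rw [isFullyLightLike_omegaTwo_iff he hon hcov (by norm_num),
    isFullyLightLike_omegaTwo_iff he hon hcov (by norm_num)]
  have hμ2 : μ ^ 2 = 1 := by rcases hμ with rfl | rfl <;> norm_num
  have hex {g : Base m → ℝ} (hg : ∀ x, fderiv ℝ g x ≠ 0) (c : ℝ) (x : Base m) :
      ∃ X, Real.exp c * fderiv ℝ g x X ≠ 0 := by
    obtain ⟨X, hX⟩ := DFunLike.ne_iff.1 (hg x)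
    exact ⟨X, mul_ne_zero (Real.exp_pos c).ne' hX⟩
  rcases hΓ with hΓ | hΓ
  · refine ⟨fun x ↦ ⟨fun X ↦ ?_, ?_⟩, fun x ↦ ⟨fun X ↦ ?_, ?_⟩⟩
    · obtain ⟨h1, h2, h3, h4⟩ := hΓ x X
      rw [h1, h2, h3, h4]
      linear_combination (-(Real.exp (μ * fp x) * fderiv ℝ gp x X) ^ 2) * hμ2
    · obtain ⟨X, hX⟩ := hex hgp (μ * fp x) x
      refine ⟨X, fun h0 ↦ hX ?_⟩
      obtain ⟨h1, h2, h3, h4⟩ := hΓ x X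
      rw [h2, h3] at h0
      linear_combination h0
    · obtain ⟨h1, h2, h3, h4⟩ := hΓ x X
      rw [h1, h2, h3, h4]
      linear_combination (-(Real.exp (μ * fm x) * fderiv ℝ gm x X) ^ 2) * hμ2
    · obtain ⟨X, hX⟩ := hex hgm (μ * fm x) x
      refine ⟨X, fun h0 ↦ hX ?_⟩
      obtain ⟨h1, h2, h3, h4⟩ := hΓ x X
      rw [h2, h3] at h0
      linear_combination h0
  · refine ⟨fun x ↦ ⟨fun X ↦ ?_, ?_⟩, fun x ↦ ⟨fun X ↦ ?_, ?_⟩⟩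
    · obtain ⟨h1, h2, h3, h4⟩ := hΓ x X
      rw [h1, h2, h3, h4]
      linear_combination (-(Real.exp (μ * fp x) * fderiv ℝ gp x X) ^ 2) * hμ2
    · obtain ⟨X, hX⟩ := hex hgp (μ * fp x) x
      refine ⟨X, fun h0 ↦ hX ?_⟩
      obtain ⟨h1, h2, h3, h4⟩ := hΓ x X
      rw [h2, h3] at h0
      linear_combination h0
    · obtain ⟨h1, h2, h3, h4⟩ := hΓ x X
      rw [h1, h2, h3, h4]
      linear_combination (-(Real.exp (-μ * fm x) * fderiv ℝ gm x X) ^ 2) * hμ2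
    · obtain ⟨X, hX⟩ := hex hgm (-μ * fm x) x
      refine ⟨X, fun h0 ↦ hX ?_⟩
      obtain ⟨h1, h2, h3, h4⟩ := hΓ x X
      rw [h2, h3] at h0
      linear_combination h0

/-- The forms `θ = ω^3_2 + ε ω^4_1`, `φ = ω^2_1 + ε ω^4_3` and `ψ = ω^3_1 - ε ω^4_2` are the
components of the connection form in one of the two summands of `so(2,2)`; by flatness they satisfy
the structure equations of a flat `sl(2)`-connection, to which `exists_potentials` applies. -/
theorem exists_potentials_of_isFullyLightLike (hflat : IsFlatConnection cov)
    (hsm : ∀ j (X : Base m), SmoothSection fun x ↦ cov (e j) x X) {ε : ℝ} (hε : ε ^ 2 = 1)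
    (hΩ : IsFullyLightLike h cov (fun x ↦ omegaTwo ε (fun i ↦ e i x))) :
    ∃ (ν : ℝ) (f g : Base m → ℝ), (ν = 1 ∨ ν = -1) ∧ ContDiff ℝ ∞ f ∧ ContDiff ℝ ∞ g ∧
      (∀ x, fderiv ℝ g x ≠ 0) ∧
      (∀ x X, fderiv ℝ f x X = connForm cov he 2 0 x X - ε * connForm cov he 3 1 x X) ∧
      (∀ x X, connForm cov he 2 1 x X + ε * connForm cov he 3 0 x X =
        Real.exp (ν * f x) * fderiv ℝ g x X) ∧
      ∀ x X, connForm cov he 1 0 x X + ε * connForm cov he 3 2 x X =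
        ν * (Real.exp (ν * f x) * fderiv ℝ g x X) := by
  have hω := contDiff_connOneForm he hon hsm
  have hωd (i j x) : DifferentiableAt ℝ (connOneForm cov he i j) x :=
    (hω i j).differentiable (by simp) x
  have hstr := fderiv_connOneForm_sub he hflat hsm hω
  have hdiff (i j k l : Fin 4) (c : ℝ) (x X Y) :
      fderiv ℝ (fun x ↦ connOneForm cov he i j x + c • connOneForm cov he k l x) x X Y =
        fderiv ℝ (connOneForm cov he i j) x X Y + c * fderiv ℝ (connOneForm cov he k l) x X Y := by
    rw [fderiv_fun_add (hωd i j x) ((hωd k l x).fun_const_smul c),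
      fderiv_fun_const_smul (hωd k l x)]
    rfl
  have hsm' (i j k l : Fin 4) (c : ℝ) :
      ContDiff ℝ ∞ (fun x ↦ connOneForm cov he i j x + c • connOneForm cov he k l x) :=
    (hω i j).add ((hω k l).const_smul c)
  rw [isFullyLightLike_omegaTwo_iff he hon hcov hε] at hΩ
  obtain ⟨ν, f, g, hν, hf, hg, hdg, hdf, hθ, hφ⟩ := exists_potentials
    (hsm' 2 1 3 0 ε) (hsm' 1 0 3 2 ε) (hsm' 2 0 3 1 (-ε))
    (fun x X Y ↦ by
      have h1 := hstr 2 1 x X Y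
      have h2 := hstr 3 0 x X Y
      obtain ⟨a00, a11, a22, a33, a01, -, -, -, -, a23⟩ :=
        connForm_skew_components he hon hcov x X
      obtain ⟨b00, b11, b22, b33, b01, -, -, -, -, b23⟩ :=
        connForm_skew_components he hon hcov x Y
      simp only [hdiff, add_apply, smul_apply, smul_eq_mul]
      simp only [Fin.sum_univ_four, connOneForm_apply, a00, a11, a22, a33, a01, a23, b00,
        b11, b22, b33, b01, b23] at h1 h2 ⊢
      rcases sq_eq_one_iff.1 hε with rfl | rfl
      · linear_combination h1 + h2
      · linear_combination h1 - h2)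
    (fun x X Y ↦ by
      have h1 := hstr 2 0 x X Y
      have h2 := hstr 3 1 x X Y
      obtain ⟨a00, a11, a22, a33, a01, -, -, -, -, a23⟩ :=
        connForm_skew_components he hon hcov x X
      obtain ⟨b00, b11, b22, b33, b01, -, -, -, -, b23⟩ :=
        connForm_skew_components he hon hcov x Y
      simp only [hdiff, add_apply, smul_apply, smul_eq_mul]
      simp only [Fin.sum_univ_four, connOneForm_apply, a00, a11, a22, a33, a01, a23, b00,
        b11, b22, b33, b01, b23] at h1 h2 ⊢
      rcases sq_eq_one_iff.1 hε with rfl | rfl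
      · linear_combination h1 - h2
      · linear_combination h1 + h2)
    (fun x X ↦ (hΩ x).1 X)
    (fun x h0 ↦ by
      obtain ⟨X, hX⟩ := (hΩ x).2
      exact hX (DFunLike.congr_fun h0 X))
  refine ⟨ν, f, g, hν, hf, hg, hdg, fun x X ↦ ?_, hθ, fun x X ↦ ?_⟩
  · rw [hdf]
    simp only [add_apply, smul_apply, smul_eq_mul, connOneForm_apply]
    ring
  · rw [← hθ]
    exact hφ x X

theorem isFullyLightLike_iff_hasShape (hflat : IsFlatConnection cov)
    (hsm : ∀ j (X : Base m), SmoothSection fun x ↦ cov (e j) x X) :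
    (IsFullyLightLike h cov (fun x ↦ omegaTwo 1 (fun i ↦ e i x)) ∧
      IsFullyLightLike h cov (fun x ↦ omegaTwo (-1) (fun i ↦ e i x))) ↔
    HasShape (connForm cov he) := by
  refine ⟨fun ⟨hp, hm⟩ ↦ ?_, isFullyLightLike_of_hasShape he hon hcov⟩
  obtain ⟨μ, fp, gp, hμ, hfp, hgp, hdgp, hdfp, hθp, hφp⟩ :=
    exists_potentials_of_isFullyLightLike he hon hcov hflat hsm (by norm_num) hp
  obtain ⟨ν, fm, gm, hν, hfm, hgm, hdgm, hdfm, hθm, hφm⟩ :=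
    exists_potentials_of_isFullyLightLike he hon hcov hflat hsm (by norm_num) hm
  -- The potential of `ω^3_1 + ω^4_2` is `-f⁻`.
  have hneg (x X) : fderiv ℝ (fun x ↦ -fm x) x X = -fderiv ℝ fm x X := by
    rw [fderiv_fun_neg]; rfl
  refine ⟨μ, fp, fun x ↦ -fm x, gp, gm, hμ, ⟨hfp, hfm.neg, hgp, hgm, hdgp, hdgm⟩,
    fun x X ↦ ⟨?_, ?_⟩, ?_⟩
  · rw [hneg]
    linear_combination (-1 / 2) * hdfp x X - (1 / 2) * hdfm x X
  · rw [hneg]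
    linear_combination (1 / 2) * hdfp x X - (1 / 2) * hdfm x X
  -- The signs of the two families agree in the second shape and differ in the first.
  have hνμ : ν = -μ ∨ ν = μ := by
    rcases hμ with rfl | rfl <;> rcases hν with rfl | rfl <;> norm_num
  rcases hνμ with rfl | rfl
  · refine Or.inl fun x X ↦ ?_
    have e1 := hθp x X
    have e2 := hφp x X
    have e3 := hθm x X
    have e4 := hφm x X
    rw [show -μ * fm x = μ * -fm x by ring] at e3 e4
    refine ⟨?_, ?_, ?_, ?_⟩
    · linear_combination (1 / 2) * e2 + (1 / 2) * e4
    · linear_combination (1 / 2) * e1 + (1 / 2) * e3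
    · linear_combination (1 / 2) * e1 - (1 / 2) * e3
    · linear_combination (1 / 2) * e2 - (1 / 2) * e4
  · refine Or.inr fun x X ↦ ?_
    have e1 := hθp x X
    have e2 := hφp x X
    have e3 := hθm x X
    have e4 := hφm x X
    rw [show ν * fm x = -ν * -fm x by ring] at e3 e4
    refine ⟨?_, ?_, ?_, ?_⟩
    · linear_combination (1 / 2) * e2 + (1 / 2) * e4
    · linear_combination (1 / 2) * e1 + (1 / 2) * e3
    · linear_combination (1 / 2) * e1 - (1 / 2) * e3
    · linear_combination (1 / 2) * e2 - (1 / 2) * e4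

end Criterion

/-! ### Sections of line fields on a vector space -/

section LineField

variable {E F : Type*} [NormedAddCommGroup E] [NormedSpace ℝ E] [ProperSpace E]
  [NormedAddCommGroup F] [InnerProductSpace ℝ F] {P : E → F →L[ℝ] F}

/-- Nearby idempotents do not annihilate each other's images. -/
theorem apply_ne_zero_of_norm_sub_lt_one {A B : F →L[ℝ] F} (hAB : ‖A - B‖ < 1) {u : F}
    (hu : u ≠ 0) (hA : A u = u) : B u ≠ 0 := fun hB ↦ by
  have h := (A - B).le_opNorm u
  rw [sub_apply, hA, hB, sub_zero] at h
  have := norm_pos_iff.2 hu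
  nlinarith

/-- A section of a field of idempotents which is nonzero on a given ball: a vector at the origin is
transported along each ray by projecting it successively, in sufficiently many steps. -/
theorem exists_section_ne_zero_on_ball (hP : ContDiff ℝ ∞ P) (hidem : ∀ x v, P x (P x v) = P x v)
    {u₀ : F} (hu₀ : u₀ ≠ 0) (hPu₀ : P 0 u₀ = u₀) (R : ℝ) :
    ∃ v : E → F, ContDiff ℝ ∞ v ∧ v 0 = u₀ ∧ (∀ x, P x (v x) = v x) ∧
      ∀ x ∈ Metric.closedBall 0 R, v x ≠ 0 := by
  have huc := (isCompact_closedBall (0 : E) R).uniformContinuousOn_of_continuous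
    hP.continuous.continuousOn
  obtain ⟨δ, hδ, hclose⟩ := Metric.uniformContinuousOn_iff.1 huc 1 one_pos
  obtain ⟨N, hN⟩ := exists_nat_gt (R / δ)
  have hstep (k : ℕ) : ∃ v : E → F, ContDiff ℝ ∞ v ∧ v 0 = u₀ ∧
      (∀ x, P (((k : ℝ) / (N + 1)) • x) (v x) = v x) ∧
      (k ≤ N + 1 → ∀ x ∈ Metric.closedBall 0 R, v x ≠ 0) := by
    induction k with
    | zero => exact ⟨fun _ ↦ u₀, contDiff_const, rfl, fun x ↦ by simpa using hPu₀, fun _ _ _ ↦ hu₀⟩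
    | succ k ih =>
      obtain ⟨v, hv, hv0, hPv, hvne⟩ := ih
      refine ⟨fun x ↦ P ((((k + 1 : ℕ) : ℝ) / (N + 1)) • x) (v x),
        (hP.comp (contDiff_const.smul contDiff_id)).clm_apply hv, by simp [hv0, hPu₀],
        fun x ↦ hidem _ _, fun hk x hx ↦ ?_⟩
      refine apply_ne_zero_of_norm_sub_lt_one ?_ (hvne (by omega) x hx) (hPv x)
      rw [mem_closedBall_zero_iff] at hx
      have hmem (j : ℕ) (hj : j ≤ N + 1) :
          ((j : ℝ) / (N + 1)) • x ∈ Metric.closedBall (0 : E) R := by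
        rw [mem_closedBall_zero_iff, norm_smul]
        have h1 : ‖(j : ℝ) / (N + 1)‖ ≤ 1 := by
          rw [Real.norm_of_nonneg (by positivity), div_le_one (by positivity)]
          exact_mod_cast hj
        nlinarith [norm_nonneg x]
      rw [← dist_eq_norm]
      refine hclose _ (hmem k (by omega)) _ (hmem (k + 1) hk) ?_
      rw [dist_eq_norm, ← sub_smul, norm_smul]
      have h2 : ‖(k : ℝ) / (N + 1) - ((k + 1 : ℕ) : ℝ) / (N + 1)‖ = 1 / (N + 1) := by
        rw [← sub_div, norm_div, Real.norm_of_nonneg (show (0 : ℝ) ≤ N + 1 by positivity)]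
        congr 1
        push_cast
        simp
      rw [h2, div_mul_eq_mul_div, one_mul, div_lt_iff₀ (by positivity)]
      rw [div_lt_iff₀ hδ] at hN
      nlinarith
  obtain ⟨v, hv, hv0, hPv, hvne⟩ := hstep (N + 1)
  refine ⟨v, hv, hv0, fun x ↦ ?_, hvne le_rfl⟩
  have h := hPv x
  rwa [Nat.cast_add, Nat.cast_one, div_self (by positivity), one_smul] at h

/-- A smooth line field on a vector space, given as the field of the images of idempotents, has a
smooth section without zeros. The sections on balls are normalised to unit length and to the same
direction at the origin, so that they agree on smaller balls. -/
theorem exists_section_ne_zero (hP : ContDiff ℝ ∞ P) (hidem : ∀ x v, P x (P x v) = P x v)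
    (hrank : ∀ x, ∃ w, P x w = w ∧ w ≠ 0 ∧ ∀ v, P x v = v → ∃ c : ℝ, v = c • w) :
    ∃ u : E → F, ContDiff ℝ ∞ u ∧ (∀ x, P x (u x) = u x) ∧ ∀ x, u x ≠ 0 := by
  obtain ⟨u₀, hPu₀, hu₀, -⟩ := hrank 0
  choose v hv hv0 hPv hvne using fun n : ℕ ↦
    exists_section_ne_zero_on_ball hP hidem hu₀ hPu₀ (n : ℝ)
  set w : ℕ → E → F := fun n x ↦ ‖v n x‖⁻¹ • v n x
  have hprop {n : ℕ} (k : ℕ) {x : E} (hx : x ∈ Metric.closedBall 0 (n : ℝ)) :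
      ∃ c : ℝ, v k x = c • v n x := by
    obtain ⟨t, -, ht, hline⟩ := hrank x
    obtain ⟨a, ha⟩ := hline _ (hPv n x)
    obtain ⟨b, hb⟩ := hline _ (hPv k x)
    have ha0 : a ≠ 0 := by rintro rfl; exact hvne n x hx (by simpa using ha)
    exact ⟨b / a, by rw [ha, hb, smul_smul, div_mul_cancel₀ _ ha0]⟩
  have hpos {n k : ℕ} (hnk : n ≤ k) {x : E} (hx : x ∈ Metric.closedBall 0 (n : ℝ)) :
      0 < inner ℝ (v n x) (v k x) := by
    have hsub : Metric.closedBall (0 : E) n ⊆ Metric.closedBall 0 k :=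
      Metric.closedBall_subset_closedBall (by exact_mod_cast hnk)
    have hne : ∀ y ∈ Metric.closedBall (0 : E) n, inner ℝ (v n y) (v k y) ≠ 0 := by
      intro y hy h0
      obtain ⟨c, hc⟩ := hprop k hy
      rw [hc, inner_smul_right, real_inner_self_eq_norm_sq] at h0
      rcases mul_eq_zero.1 h0 with h | h
      · exact hvne k y (hsub hy) (by rw [hc, h, zero_smul])
      · exact hvne n y hy (by simpa using h)
    have h0 : 0 < inner ℝ (v n 0) (v k 0) := by
      rw [hv0, hv0, real_inner_self_eq_norm_sq]
      have := norm_pos_iff.2 hu₀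
      positivity
    by_contra! hle
    have hconn := (convex_closedBall (0 : E) (n : ℝ)).isPreconnected
    obtain ⟨y, hy, hy0⟩ := hconn.intermediate_value hx
      (Metric.mem_closedBall_self (Nat.cast_nonneg n))
      ((hv n).continuous.inner (hv k).continuous).continuousOn (mem_Icc.2 ⟨hle, h0.le⟩)
    exact hne y hy hy0
  have hagree {n k : ℕ} (hnk : n ≤ k) {x : E} (hx : x ∈ Metric.closedBall 0 (n : ℝ)) :
      w k x = w n x := by
    obtain ⟨c, hc⟩ := hprop k hx
    have h := hpos hnk hx
    rw [hc, inner_smul_right, real_inner_self_eq_norm_sq] at h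
    have hc0 : 0 < c := pos_of_mul_pos_left h (sq_nonneg _)
    simp only [w]
    rw [hc, norm_smul, Real.norm_of_nonneg hc0.le, smul_smul, mul_inv, mul_right_comm,
      inv_mul_cancel₀ hc0.ne', one_mul]
  have hmem (x : E) : x ∈ Metric.closedBall (0 : E) (⌈‖x‖⌉₊ : ℝ) :=
    mem_closedBall_zero_iff.2 (Nat.le_ceil _)
  refine ⟨fun x ↦ w ⌈‖x‖⌉₊ x, contDiff_iff_contDiffAt.2 fun x ↦ ?_, fun x ↦ ?_, fun x ↦ ?_⟩
  · obtain ⟨n, hn⟩ := exists_nat_gt ‖x‖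
    have hx : x ∈ Metric.ball (0 : E) n := mem_ball_zero_iff.2 hn
    have hw : ContDiffAt ℝ ∞ (w n) x :=
      (((hv n).contDiffAt.norm ℝ (hvne n x (Metric.ball_subset_closedBall hx))).inv
        (norm_ne_zero_iff.2 (hvne n x (Metric.ball_subset_closedBall hx)))).smul (hv n).contDiffAt
    refine hw.congr_of_eventuallyEq ?_
    filter_upwards [Metric.isOpen_ball.mem_nhds hx] with y hy
    exact (hagree (Nat.ceil_le.2 (mem_ball_zero_iff.1 hy).le) (hmem y)).symm
  · simp only [w, map_smul, hPv]
  · exact smul_ne_zero (inv_ne_zero (norm_ne_zero_iff.2 (hvne _ x (hmem x)))) (hvne _ x (hmem x))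

end LineField

/-! ### Bases adapted to paracomplex structures -/

section AdaptedBases

variable {W : Type*} [AddCommGroup W] [Module ℝ W]

theorem form_eq_sum_repr {h : LinearMap.BilinForm ℝ W} {b : Module.Basis (Fin 4) ℝ W}
    (hb : ∀ i j, h (b i) (b j) = if i = j then sgn i else 0) (v w : W) :
    h v w = ∑ i, sgn i * b.repr v i * b.repr w i := by
  conv_lhs => rw [← b.sum_repr v, ← b.sum_repr w]
  simp only [map_sum, map_smul, LinearMap.sum_apply, LinearMap.smul_apply, hb, smul_eq_mul]
  simp only [mul_ite, mul_zero, Finset.sum_ite_eq', Finset.mem_univ, if_true]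
  exact Finset.sum_congr rfl fun i _ ↦ by ring

theorem repr_eq_form {h : LinearMap.BilinForm ℝ W} {b : Module.Basis (Fin 4) ℝ W}
    (hb : ∀ i j, h (b i) (b j) = if i = j then sgn i else 0) (v : W) (i : Fin 4) :
    b.repr v i = sgn i * h (b i) v := by
  rw [form_eq_sum_repr hb]
  simp [Finsupp.single_apply, ← mul_assoc, sgn_mul_self]

theorem eq_sum_form_smul {h : LinearMap.BilinForm ℝ W} {b : Module.Basis (Fin 4) ℝ W}
    (hb : ∀ i j, h (b i) (b j) = if i = j then sgn i else 0) (v : W) :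
    v = ∑ i, (sgn i * h (b i) v) • b i := by
  conv_lhs => rw [← b.sum_repr v]
  simp only [repr_eq_form hb]

/-- In an adapted basis, `Ω_{ε,2}` is the bivector of `J` up to a factor. -/
theorem sum_sgn_smul_wedge_eq_omegaTwo {ε : ℝ} {J : W →ₗ[ℝ] W} {b : Fin 4 → W}
    (hJ : IsAdapted ε J b) :
    ∑ i, sgn i • wedge (b i) (J (b i)) = (2 * √2) • omegaTwo ε b := by
  obtain ⟨h0, h1, h2, h3⟩ := hJ
  have h4 : 2 * √2 * (1 / √2) = (2 : ℝ) := by field_simp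
  simp only [Fin.sum_univ_four, h0, h1, h2, h3, wedge_smul_right, omegaTwo, smul_smul, h4]
  rw [wedge_swap (b 2) (b 0), wedge_swap (b 1) (b 3)]
  simp [sgn]
  module

/-- `Ω_{ε,2}` depends only on the paracomplex structure: up to a factor it is the bivector
`∑ i, sgn i • b i ∧ J (b i)`, which is the same for all pseudo-orthonormal bases. -/
theorem omegaTwo_eq_of_isAdapted {h : LinearMap.BilinForm ℝ W} (hsymm : ∀ v w, h v w = h w v)
    {b b' : Module.Basis (Fin 4) ℝ W}
    (hb : ∀ i j, h (b i) (b j) = if i = j then sgn i else 0)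
    (hb' : ∀ i j, h (b' i) (b' j) = if i = j then sgn i else 0)
    {ε : ℝ} {J : W →ₗ[ℝ] W} (hJ : IsAdapted ε J b) (hJ' : IsAdapted ε J b') :
    omegaTwo ε b' = omegaTwo ε b := by
  have key : ∑ i, sgn i • wedge (b' i) (J (b' i)) = ∑ i, sgn i • wedge (b i) (J (b i)) := by
    have h1 (i) : sgn i • wedge (b' i) (J (b' i)) =
        ∑ k, sgn k • wedge (b k) (J ((sgn i * h (b' i) (b k)) • b' i)) := by
      conv_lhs => rw [eq_sum_form_smul hb (b' i), wedge_sum_left, Finset.smul_sum]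
      refine Finset.sum_congr rfl fun k _ ↦ ?_
      rw [← eq_sum_form_smul hb (b' i), wedge_smul_left, map_smul, wedge_smul_right, hsymm (b k)]
      module
    have h2 (k) : b k = ∑ i, (sgn i * h (b' i) (b k)) • b' i := eq_sum_form_smul hb' (b k)
    simp only [h1]
    rw [Finset.sum_comm]
    refine Finset.sum_congr rfl fun k _ ↦ ?_
    conv_rhs => rw [h2 k]
    rw [← h2 k, ← Finset.smul_sum, ← wedge_sum_right, ← map_sum, ← h2 k]
  rw [sum_sgn_smul_wedge_eq_omegaTwo hJ, sum_sgn_smul_wedge_eq_omegaTwo hJ'] at key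
  exact smul_right_injective _ (by positivity) key

theorem repr_apply_of_isAdapted {b : Module.Basis (Fin 4) ℝ W} {ε : ℝ} {J : W →ₗ[ℝ] W}
    (hJ : IsAdapted ε J b) (v : W) :
    b.repr (J v) 0 = b.repr v 2 ∧ b.repr (J v) 1 = -ε * b.repr v 3 ∧
      b.repr (J v) 2 = b.repr v 0 ∧ b.repr (J v) 3 = -ε * b.repr v 1 := by
  obtain ⟨h0, h1, h2, h3⟩ := hJ
  have hv : J v = b.repr v 0 • b 2 + b.repr v 1 • (-ε • b 3) + b.repr v 2 • b 0 +
      b.repr v 3 • (-ε • b 1) := by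
    conv_lhs => rw [← b.sum_repr v]
    simp only [Fin.sum_univ_four, map_add, map_smul, h0, h1, h2, h3]
  rw [hv]
  simp [mul_comm]

theorem det_fin_four (A : Matrix (Fin 4) (Fin 4) ℝ) :
    A.det =
      A 0 0 * (A 1 1 * (A 2 2 * A 3 3 - A 2 3 * A 3 2) - A 1 2 * (A 2 1 * A 3 3 - A 2 3 * A 3 1) +
        A 1 3 * (A 2 1 * A 3 2 - A 2 2 * A 3 1)) -
      A 0 1 * (A 1 0 * (A 2 2 * A 3 3 - A 2 3 * A 3 2) - A 1 2 * (A 2 0 * A 3 3 - A 2 3 * A 3 0) +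
        A 1 3 * (A 2 0 * A 3 2 - A 2 2 * A 3 0)) +
      A 0 2 * (A 1 0 * (A 2 1 * A 3 3 - A 2 3 * A 3 1) - A 1 1 * (A 2 0 * A 3 3 - A 2 3 * A 3 0) +
        A 1 3 * (A 2 0 * A 3 1 - A 2 1 * A 3 0)) -
      A 0 3 * (A 1 0 * (A 2 1 * A 3 2 - A 2 2 * A 3 1) - A 1 1 * (A 2 0 * A 3 2 - A 2 2 * A 3 0) +
        A 1 2 * (A 2 0 * A 3 1 - A 2 1 * A 3 0)) := by
  rw [Matrix.det_succ_row_zero]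
  simp [Fin.sum_univ_four, Matrix.det_fin_three, Fin.succAbove, Matrix.submatrix]
  ring

/-- The orientation of a pseudo-orthonormal basis adapted to a paracomplex structure is determined
by the structure: the change of basis between two of them has determinant `1`. -/
theorem orientation_eq_of_isAdapted {h : LinearMap.BilinForm ℝ W}
    {b b' : Module.Basis (Fin 4) ℝ W}
    (hb : ∀ i j, h (b i) (b j) = if i = j then sgn i else 0)
    (hb' : ∀ i j, h (b' i) (b' j) = if i = j then sgn i else 0)
    {ε : ℝ} (hε : ε ^ 2 = 1) {J : W →ₗ[ℝ] W} (hJ : IsAdapted ε J b) (hJ' : IsAdapted ε J b') :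
    b'.orientation = b.orientation := by
  rw [eq_comm, b.orientation_eq_iff_det_pos]
  suffices b.det b' = 1 by rw [this]; exact one_pos
  obtain ⟨h0, h1, -, -⟩ := hJ'
  obtain ⟨x0, x1, x2, x3⟩ := repr_apply_of_isAdapted hJ (b' 0)
  obtain ⟨y0, y1, y2, y3⟩ := repr_apply_of_isAdapted hJ (b' 1)
  have e3 (i) : b.repr (b' 3) i = -ε * b.repr (J (b' 1)) i := by
    rw [h1, map_smul, Finsupp.smul_apply, smul_eq_mul]
    linear_combination (-b.repr (b' 3) i) * hε
  have o00 := hb' 0 0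
  have o01 := hb' 0 1
  have o11 := hb' 1 1
  have o03 := hb' 0 3
  rw [form_eq_sum_repr hb] at o00 o01 o11 o03
  rw [Module.Basis.det_apply, det_fin_four]
  simp only [Module.Basis.toMatrix_apply, e3, y0, y1, y2, y3, ← h0, x0, x1, x2, x3,
    Fin.sum_univ_four] at o00 o01 o11 o03 ⊢
  generalize b.repr (b' 0) = x at *
  generalize b.repr (b' 1) = y at *
  simp [sgn] at o00 o01 o11 o03
  -- The determinant is that of the Gram matrix of `b' 0`, `b' 1` corrected by `h (b' 0) (b' 3)`.
  rcases sq_eq_one_iff.1 hε with rfl | rfl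
  · linear_combination (y 0 * y 0 + y 1 * y 1 - y 2 * y 2 - y 3 * y 3) * o00 + o11 -
      (x 0 * y 0 + x 1 * y 1 - x 2 * y 2 - x 3 * y 3) * o01 +
      (-x 0 * y 2 + x 1 * y 3 + x 2 * y 0 - x 3 * y 1) * o03
  · linear_combination (y 0 * y 0 + y 1 * y 1 - y 2 * y 2 - y 3 * y 3) * o00 + o11 -
      (x 0 * y 0 + x 1 * y 1 - x 2 * y 2 - x 3 * y 3) * o01 +
      (x 0 * y 2 + x 1 * y 3 - x 2 * y 0 - x 3 * y 1) * o03

/-- The change of basis `A` satisfies `Aᵀ η A = η`. -/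
theorem det_sq_eq_one_of_orthonormal {h : LinearMap.BilinForm ℝ W}
    {b b' : Module.Basis (Fin 4) ℝ W}
    (hb : ∀ i j, h (b i) (b j) = if i = j then sgn i else 0)
    (hb' : ∀ i j, h (b' i) (b' j) = if i = j then sgn i else 0) : b.det b' ^ 2 = 1 := by
  have h1 : (b.toMatrix b').transpose * Matrix.diagonal sgn * b.toMatrix b' =
      Matrix.diagonal sgn := by
    ext i j
    rw [Matrix.mul_apply, Matrix.diagonal_apply, ← hb' i j, form_eq_sum_repr hb]
    simp only [Matrix.mul_diagonal, Matrix.transpose_apply, Module.Basis.toMatrix_apply]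
    exact Finset.sum_congr rfl fun k _ ↦ by ring
  have h2 := congrArg Matrix.det h1
  rw [Matrix.det_mul, Matrix.det_mul, Matrix.det_transpose, Matrix.det_diagonal,
    ← Module.Basis.det_apply] at h2
  have h3 : ∏ i, sgn i = 1 := by simp [Fin.prod_univ_four, sgn]
  rw [h3] at h2
  linear_combination h2

/-- The algebra behind the splitting `so(2,2) = sl(2) ⊕ sl(2)`: a skew-symmetric matrix `n` with
`n η n = η` and Pfaffian `-1` lies in one of the two summands. -/
theorem antiSelfDual_of_pfaffian {n01 n02 n03 n12 n13 n23 : ℝ}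
    (e00 : n02 ^ 2 + n03 ^ 2 - n01 ^ 2 = 1) (e11 : n12 ^ 2 + n13 ^ 2 - n01 ^ 2 = 1)
    (e22 : n02 ^ 2 + n12 ^ 2 - n23 ^ 2 = 1) (e33 : n03 ^ 2 + n13 ^ 2 - n23 ^ 2 = 1)
    (e01 : n02 * n12 + n03 * n13 = 0) (e02 : n01 * n12 + n03 * n23 = 0)
    (e03 : n01 * n13 = n02 * n23) (e12 : n01 * n02 = n13 * n23)
    (e13 : n01 * n03 + n12 * n23 = 0) (e23 : n02 * n03 + n12 * n13 = 0)
    (hpf : n01 * n23 - n02 * n13 + n03 * n12 = -1) :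
    n13 = n02 ∧ n23 = n01 ∧ n12 = -n03 := by
  have hT : (n02 + n13) ^ 2 + (n03 - n12) ^ 2 - (n01 + n23) ^ 2 = 4 := by
    linear_combination e00 + e11 / 2 + e22 / 2 - 2 * hpf + e33 / 2 - e00 / 2
  have p11 : (n13 - n02) * (n02 + n13) = 0 := by linear_combination (e33 - e00 + e11 - e22) / 2
  have p12 : (n13 - n02) * (n01 + n23) = 0 := by linear_combination e03 - e12
  have p13 : (n13 - n02) * (n03 - n12) = 0 := by linear_combination e01 - e23
  have p21 : (n23 - n01) * (n02 + n13) = 0 := by linear_combination -e03 - e12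
  have p22 : (n23 - n01) * (n01 + n23) = 0 := by linear_combination (e11 - e33 + e00 - e22) / 2
  have p23 : (n23 - n01) * (n03 - n12) = 0 := by linear_combination e02 - e13
  have p31 : (n12 + n03) * (n02 + n13) = 0 := by linear_combination e01 + e23
  have p32 : (n12 + n03) * (n01 + n23) = 0 := by linear_combination e02 + e13
  have p33 : (n12 + n03) * (n03 - n12) = 0 := by linear_combination (e00 - e22 + e33 - e11) / 2
  refine ⟨?_, ?_, ?_⟩
  · linear_combination ((n02 + n13) * p11 + (n03 - n12) * p13 - (n01 + n23) * p12) / 4 -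
      (n13 - n02) / 4 * hT
  · linear_combination ((n02 + n13) * p21 + (n03 - n12) * p23 - (n01 + n23) * p22) / 4 -
      (n23 - n01) / 4 * hT
  · linear_combination ((n02 + n13) * p31 + (n03 - n12) * p33 - (n01 + n23) * p32) / 4 -
      (n12 + n03) / 4 * hT

/-- If `J` is adapted, with sign `-1`, to a pseudo-orthonormal basis `b'`, then in any
pseudo-orthonormal basis `b` of the same orientation `J` has the form of a general element of the
anti-self-dual summand of `so(2,2)`. -/
theorem exists_antiSelfDual_matrix {h : LinearMap.BilinForm ℝ W}
    {b b' : Module.Basis (Fin 4) ℝ W}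
    (hb : ∀ i j, h (b i) (b j) = if i = j then sgn i else 0)
    (hb' : ∀ i j, h (b' i) (b' j) = if i = j then sgn i else 0)
    (hor : b'.orientation = b.orientation) {J : W →ₗ[ℝ] W} (hJ' : IsAdapted (-1) J b')
    (hJJ : ∀ v, J (J v) = v) :
    ∃ p q r : ℝ, J (b 0) = p • b 1 + q • b 2 + r • b 3 ∧
      J (b 1) = -p • b 0 - r • b 2 + q • b 3 ∧ J (b 2) = q • b 0 - r • b 1 - p • b 3 ∧
      J (b 3) = r • b 0 + q • b 1 + p • b 2 := by
  have hdet : b.det b' = 1 := by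
    have h1 := (b.orientation_eq_iff_det_pos b').1 hor.symm
    have h2 := det_sq_eq_one_of_orthonormal hb hb'
    nlinarith
  obtain ⟨j0, j1, j2, j3⟩ := hJ'
  have hB (k l) : b.repr (J (b l)) k = sgn l *
      (b.repr (b' 0) l * b.repr (b' 2) k + b.repr (b' 1) l * b.repr (b' 3) k
        - b.repr (b' 2) l * b.repr (b' 0) k - b.repr (b' 3) l * b.repr (b' 1) k) := by
    have h1 (i) : h (b' i) (b l) = sgn l * b.repr (b' i) l := by
      rw [form_eq_sum_repr hb]
      simp [Finsupp.single_apply]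
    have h2 := congrArg (fun v ↦ b.repr (J v) k) (eq_sum_form_smul hb' (b l))
    simp only [Fin.sum_univ_four, map_add, map_smul, j0, j1, j2, j3, h1, Finsupp.add_apply,
      Finsupp.smul_apply, smul_eq_mul] at h2
    rw [h2]
    simp [sgn]
    ring
  rw [Module.Basis.det_apply, det_fin_four] at hdet
  simp only [Module.Basis.toMatrix_apply] at hdet
  have hsq (k l) : ∑ i, b.repr (J (b l)) i * b.repr (J (b i)) k = if l = k then 1 else 0 := by
    have h1 := congrArg (fun v ↦ b.repr (J v) k) (b.sum_repr (J (b l)))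
    simp only [hJJ, map_sum, map_smul, Finsupp.coe_finsetSum, Finset.sum_apply,
      Finsupp.smul_apply, smul_eq_mul, b.repr_self_apply] at h1
    exact h1
  -- `n` is the matrix of `J` in the basis `b`, with an index lowered by `h`.
  obtain ⟨n, hn, hskew, hpf⟩ : ∃ n : Fin 4 → Fin 4 → ℝ,
      (∀ k l, b.repr (J (b l)) k = sgn l * n k l) ∧ (∀ k l, n l k = -n k l) ∧
      n 0 1 * n 2 3 - n 0 2 * n 1 3 + n 0 3 * n 1 2 = -1 :=
    ⟨_, hB, fun k l ↦ by ring, by linear_combination -hdet⟩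
  have hd (i) : n i i = 0 := self_eq_neg.1 (hskew i i)
  simp only [hn, Fin.sum_univ_four] at hsq
  have e00 := hsq 0 0
  have e11 := hsq 1 1
  have e22 := hsq 2 2
  have e33 := hsq 3 3
  have e01 := hsq 0 1
  have e02 := hsq 0 2
  have e03 := hsq 0 3
  have e12 := hsq 1 2
  have e13 := hsq 1 3
  have e23 := hsq 2 3
  simp [sgn, hd, hskew 0 1, hskew 0 2, hskew 0 3, hskew 1 2, hskew 1 3, hskew 2 3]
    at e00 e11 e22 e33 e01 e02 e03 e12 e13 e23
  obtain ⟨h13, h23, h12⟩ := antiSelfDual_of_pfaffian (n01 := n 0 1) (n02 := n 0 2) (n03 := n 0 3)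
    (n12 := n 1 2) (n13 := n 1 3) (n23 := n 2 3) (by linear_combination e00)
    (by linear_combination e11) (by linear_combination e22) (by linear_combination e33)
    (by linear_combination e01) (by linear_combination -e02) (by linear_combination -e03)
    (by linear_combination e12) (by linear_combination e13) (by linear_combination e23) hpf
  have hJb (l) : J (b l) = ∑ k, (sgn l * n k l) • b k := by
    conv_lhs => rw [← b.sum_repr (J (b l))]
    simp only [hn]
  refine ⟨-n 0 1, -n 0 2, -n 0 3, ?_, ?_, ?_, ?_⟩ <;> rw [hJb, Fin.sum_univ_four] <;>
    simp [sgn, hd, hskew 0 1, hskew 0 2, hskew 0 3, hskew 1 2, hskew 1 3, hskew 2 3, h13, h23,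
      h12]

theorem exists_generator_of_trace_eq_one [FiniteDimensional ℝ W] {P : W →ₗ[ℝ] W}
    (hidem : ∀ v, P (P v) = P v) (htr : LinearMap.trace ℝ W P = 1) :
    ∃ w, P w = w ∧ w ≠ 0 ∧ ∀ v, P v = v → ∃ c : ℝ, v = c • w := by
  have hproj : LinearMap.IsProj (LinearMap.range P) P :=
    ⟨fun v ↦ LinearMap.mem_range_self P v, by rintro _ ⟨v, rfl⟩; exact hidem v⟩
  have hrank : Module.finrank ℝ (LinearMap.range P) = 1 := by
    have := hproj.trace
    rw [htr] at this
    exact_mod_cast this.symm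
  obtain ⟨⟨w, hw⟩, hw0, hspan⟩ := finrank_eq_one_iff'.1 hrank
  refine ⟨w, hproj.map_id w hw, fun h ↦ hw0 (Subtype.ext h), fun v hv ↦ ?_⟩
  obtain ⟨c, hc⟩ := hspan ⟨v, v, hv⟩
  exact ⟨c, (congrArg Subtype.val hc).symm⟩

/-- The projection onto the joint eigenspace of two commuting involutions `J` and `K`, for the
eigenvalues `σ` and `τ` (signs). -/
def jointProj (σ τ : ℝ) (J K : W →ₗ[ℝ] W) : W →ₗ[ℝ] W :=
  (1 / 4 : ℝ) • ((LinearMap.id + σ • J) ∘ₗ (LinearMap.id + τ • K))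

theorem jointProj_apply (σ τ : ℝ) (J K : W →ₗ[ℝ] W) (v : W) :
    jointProj σ τ J K v = (1 / 4 : ℝ) • (v + τ • K v + σ • J v + (σ * τ) • J (K v)) := by
  simp [jointProj]
  module

theorem left_jointProj {J : W →ₗ[ℝ] W} (hJ : ∀ v, J (J v) = v) (K : W →ₗ[ℝ] W) {σ : ℝ}
    (hσ : σ = 1 ∨ σ = -1) (τ : ℝ) (v : W) :
    J (jointProj σ τ J K v) = σ • jointProj σ τ J K v := by
  simp only [jointProj_apply, map_smul, map_add, hJ]
  rcases hσ with rfl | rfl <;> module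

theorem right_jointProj {J K : W →ₗ[ℝ] W} (hK : ∀ v, K (K v) = v) (hJK : ∀ v, J (K v) = K (J v))
    (σ : ℝ) {τ : ℝ} (hτ : τ = 1 ∨ τ = -1) (v : W) :
    K (jointProj σ τ J K v) = τ • jointProj σ τ J K v := by
  simp only [jointProj_apply, map_smul, map_add, ← hJK, hK]
  rcases hτ with rfl | rfl <;> module

theorem jointProj_idem {J K : W →ₗ[ℝ] W} (hJ : ∀ v, J (J v) = v) (hK : ∀ v, K (K v) = v)
    (hJK : ∀ v, J (K v) = K (J v)) {σ τ : ℝ} (hσ : σ = 1 ∨ σ = -1) (hτ : τ = 1 ∨ τ = -1) (v : W) :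
    jointProj σ τ J K (jointProj σ τ J K v) = jointProj σ τ J K v := by
  rw [jointProj_apply σ τ J K (jointProj σ τ J K v), right_jointProj hK hJK σ hτ, map_smul,
    left_jointProj hJ K hσ]
  rcases hσ with rfl | rfl <;> rcases hτ with rfl | rfl <;> module

/-- Since `J` and `K` are skew with respect to `h`, the joint eigenspaces for opposite pairs of
eigenvalues are dual to each other. -/
theorem form_jointProj {h : LinearMap.BilinForm ℝ W} {J K : W →ₗ[ℝ] W}
    (hJ : ∀ v, J (J v) = v) (hK : ∀ v, K (K v) = v) (hJK : ∀ v, J (K v) = K (J v))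
    (hhJ : ∀ v w, h (J v) (J w) = -h v w) (hhK : ∀ v w, h (K v) (K w) = -h v w) (σ τ : ℝ)
    (v w : W) : h v (jointProj (-σ) (-τ) J K w) = h (jointProj σ τ J K v) w := by
  have h1 (v w) : h (J v) w = -h v (J w) := by rw [← hhJ, hJ]
  have h2 (v w) : h (K v) w = -h v (K w) := by rw [← hhK, hK]
  simp only [jointProj_apply, map_add, map_smul, LinearMap.add_apply, LinearMap.smul_apply,
    smul_eq_mul, h1, h2, ← hJK]
  ring

theorem trace_eq_sum_repr (b : Module.Basis (Fin 4) ℝ W) (f : W →ₗ[ℝ] W) :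
    LinearMap.trace ℝ W f = ∑ i, b.repr (f (b i)) i := by
  simp [LinearMap.trace_eq_matrix_trace ℝ b, Matrix.trace, LinearMap.toMatrix_apply]

section Pair

variable {h : LinearMap.BilinForm ℝ W} {b b' : Module.Basis (Fin 4) ℝ W}
  (hb : ∀ i j, h (b i) (b j) = if i = j then sgn i else 0)
  (hb' : ∀ i j, h (b' i) (b' j) = if i = j then sgn i else 0)
  (hor : b'.orientation = b.orientation) {J K : W →ₗ[ℝ] W} (hJ : IsAdapted 1 J b)
  (hK : IsAdapted (-1) K b') (hKK : ∀ v, K (K v) = v)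
include hb hb' hor hJ hK hKK

/-- Paracomplex structures of opposite signs commute, since they lie in different summands of
`so(2,2)`. -/
theorem commute_of_isAdapted (v : W) : J (K v) = K (J v) := by
  obtain ⟨p, q, r, k0, k1, k2, k3⟩ := exists_antiSelfDual_matrix hb hb' hor hK hKK
  obtain ⟨j0, j1, j2, j3⟩ := hJ
  suffices J ∘ₗ K = K ∘ₗ J from LinearMap.congr_fun this v
  refine b.ext fun i ↦ ?_
  fin_cases i <;>
    simp [k0, k1, k2, k3, j0, j1, j2, j3] <;> module

/-- Each joint eigenspace of two paracomplex structures of opposite signs is a line. -/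
theorem trace_jointProj (σ τ : ℝ) : LinearMap.trace ℝ W (jointProj σ τ J K) = 1 := by
  obtain ⟨p, q, r, k0, k1, k2, k3⟩ := exists_antiSelfDual_matrix hb hb' hor hK hKK
  obtain ⟨j0, j1, j2, j3⟩ := hJ
  rw [trace_eq_sum_repr b, Fin.sum_univ_four]
  simp only [jointProj_apply]
  simp [k0, k1, k2, k3, j0, j1, j2, j3]
  ring

end Pair

/-- Null vectors in the four joint eigenspaces of `J` and `K`, normalised suitably, combine to a
pseudo-orthonormal quadruple adapted to both. -/
theorem adapted_of_null_vectors {h : LinearMap.BilinForm ℝ W} (hsymm : ∀ v w, h v w = h w v)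
    {J K : W →ₗ[ℝ] W} (hhJ : ∀ v w, h (J v) (J w) = -h v w)
    (hhK : ∀ v w, h (K v) (K w) = -h v w) {u v w z : W} (hJu : J u = u) (hKu : K u = u)
    (hJv : J v = -v) (hKv : K v = -v) (hJw : J w = w) (hKw : K w = -w) (hJz : J z = -z)
    (hKz : K z = z) (huv : h u v = 2) (hwz : h w z = 2) :
    let b : Fin 4 → W := ![(1 / 2 : ℝ) • (u + v), (1 / 2 : ℝ) • (w + z), (1 / 2 : ℝ) • (u - v),
      (1 / 2 : ℝ) • (z - w)]
    (∀ i j, h (b i) (b j) = if i = j then sgn i else 0) ∧ IsAdapted 1 J b ∧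
      IsAdapted (-1) K b := by
  intro b
  have uu : h u u = 0 := by have := hhJ u u; rw [hJu] at this; linarith
  have vv : h v v = 0 := by
    have := hhJ v v; simp only [hJv, map_neg, LinearMap.neg_apply] at this; linarith
  have ww : h w w = 0 := by have := hhJ w w; rw [hJw] at this; linarith
  have zz : h z z = 0 := by have := hhK z z; rw [hKz] at this; linarith
  have uw : h u w = 0 := by have := hhJ u w; rw [hJu, hJw] at this; linarith
  have uz : h u z = 0 := by have := hhK u z; rw [hKu, hKz] at this; linarith
  have vw : h v w = 0 := by
    have := hhK v w; simp only [hKv, hKw, map_neg, LinearMap.neg_apply] at this; linarith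
  have vz : h v z = 0 := by
    have := hhJ v z; simp only [hJv, hJz, map_neg, LinearMap.neg_apply] at this; linarith
  have vu := (hsymm v u).trans huv
  have zw := (hsymm z w).trans hwz
  have wu := (hsymm w u).trans uw
  have zu := (hsymm z u).trans uz
  have wv := (hsymm w v).trans vw
  have zv := (hsymm z v).trans vz
  refine ⟨fun i j ↦ ?_, ?_, ?_⟩
  · fin_cases i <;> fin_cases j <;>
      simp [b, sgn, uu, vv, ww, zz, uw, uz, vw, vz, huv, hwz, vu, zw, wu, zu, wv, zv] <;> norm_num
  · refine ⟨?_, ?_, ?_, ?_⟩ <;> simp [b, hJu, hJv, hJw, hJz] <;> module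
  · refine ⟨?_, ?_, ?_, ?_⟩ <;> simp [b, hKu, hKv, hKw, hKz] <;> module

end AdaptedBases

/-! ### Common adapted frames on the flat neutral space -/

section OrthonormalFrames

variable {m : ℕ} {V : Base m → Type*} [TopologicalSpace (TotalSpace Fib V)]
  [∀ x, AddCommGroup (V x)] [∀ x, Module ℝ (V x)] [∀ x, TopologicalSpace (V x)]
  [FiberBundle Fib V]

theorem isLocalFrameOn_of_orthonormal (h : NeutralMetric V) {e : Fin 4 → Π x, V x}
    (hsm : ∀ i, SmoothSection (e i))
    (hon : ∀ x i j, h.form x (e i x) (e j x) = if i = j then sgn i else 0) :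
    IsLocalFrameOn 𝓘(ℝ, Base m) Fib ∞ e univ := by
  have hli (x) : LinearIndependent ℝ (fun i ↦ e i x) := by
    refine Fintype.linearIndependent_iff.2 fun c hc j ↦ ?_
    have h1 := congrArg (h.form x (e j x)) hc
    simp only [map_sum, map_smul, hon, map_zero, smul_eq_mul, mul_ite, mul_zero, Finset.sum_ite_eq,
      Finset.mem_univ, if_true] at h1
    linear_combination sgn j * h1 - c j * sgn_mul_self j
  refine ⟨fun {x} _ ↦ hli x, fun {x} _ ↦ ?_, fun i ↦ (hsm i).contMDiffOn⟩
  obtain ⟨b, -⟩ := h.neutral x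
  exact ((hli x).span_eq_top_of_card_eq_finrank
    (by rw [Module.finrank_eq_card_basis b])).ge

theorem IsParacomplex.exists_basis {h : NeutralMetric V} {o : BundleOrientation V} {ε : ℝ}
    {J : ∀ x, V x →ₗ[ℝ] V x} (hJ : IsParacomplex h o ε J) (x : Base m) :
    ∃ b : Module.Basis (Fin 4) ℝ (V x),
      (∀ i j, h.form x (b i) (b j) = if i = j then sgn i else 0) ∧
      b.orientation = o.orient x ∧ IsAdapted ε (J x) b := by
  obtain ⟨u, -, hx, e, he, hJe⟩ := hJ.admissible x
  have hcoe : ⇑(he.frame.toBasisAt hx) = fun i ↦ e i x :=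
    funext fun i ↦ he.frame.toBasisAt_coe hx i
  refine ⟨he.frame.toBasisAt hx, fun i j ↦ ?_, he.oriented x hx, ?_⟩
  · simpa only [hcoe] using he.orthonormal x hx i j
  · rw [hcoe]
    exact hJe x hx

/-- A smooth pseudo-orthonormal frame adapted to a paracomplex structure has the orientation of the
bundle. -/
theorem IsParacomplex.isOrientedFrameOn {h : NeutralMetric V} {o : BundleOrientation V} {ε : ℝ}
    (hε : ε ^ 2 = 1) {J : ∀ x, V x →ₗ[ℝ] V x} (hJ : IsParacomplex h o ε J) {e : Fin 4 → Π x, V x}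
    (hsm : ∀ i, SmoothSection (e i))
    (hon : ∀ x i j, h.form x (e i x) (e j x) = if i = j then sgn i else 0)
    (had : ∀ x, IsAdapted ε (J x) (fun i ↦ e i x)) : IsOrientedFrameOn h o e univ where
  frame := isLocalFrameOn_of_orthonormal h hsm hon
  orthonormal x _ := hon x
  oriented x hx := by
    obtain ⟨b, hb, hbo, hbJ⟩ := hJ.exists_basis x
    set b' := (isLocalFrameOn_of_orthonormal h hsm hon).toBasisAt hx
    have hcoe : ⇑b' = fun i ↦ e i x :=
      funext fun i ↦ (isLocalFrameOn_of_orthonormal h hsm hon).toBasisAt_coe hx i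
    rw [← hbo]
    exact orientation_eq_of_isAdapted hb (fun i j ↦ by simpa only [hcoe] using hon x i j) hε hbJ
      (by rw [hcoe]; exact had x)

theorem IsTwistorSection.eq_omegaTwo {h : NeutralMetric V} {o : BundleOrientation V} {ε : ℝ}
    {J : ∀ x, V x →ₗ[ℝ] V x} {Ω : ∀ x, ⋀[ℝ]^2 (V x)} (hΩ : IsTwistorSection h o ε J Ω)
    {e : Fin 4 → Π x, V x} (he : IsOrientedFrameOn h o e univ)
    (had : ∀ x, IsAdapted ε (J x) (fun i ↦ e i x)) : Ω = fun x ↦ omegaTwo ε (fun i ↦ e i x) := by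
  funext x
  obtain ⟨b, hb, -, hbJ, hbΩ⟩ := hΩ x
  have hcoe : ⇑(he.frame.toBasisAt (mem_univ x)) = fun i ↦ e i x :=
    funext fun i ↦ he.frame.toBasisAt_coe (mem_univ x) i
  rw [hbΩ, ← hcoe]
  exact omegaTwo_eq_of_isAdapted (h.symm x)
    (fun i j ↦ by simpa only [hcoe] using he.orthonormal x (mem_univ x) i j) hb
    (by rw [hcoe]; exact had x) hbJ

end OrthonormalFrames

section FlatConnection

theorem isMetricConnection_flat : IsMetricConnection flatMetric flatConnection := by
  intro (σ : Base 4 → Base 4) (τ : Base 4 → Base 4) x hσ hτ X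
  have hσ' := (diffSectionAt_iff σ x).1 hσ
  have hτ' := (diffSectionAt_iff τ x).1 hτ
  have hc {f : Base 4 → Base 4} (hf : DifferentiableAt ℝ f x) (i : Fin 4) :
      HasFDerivAt (fun y ↦ f y i) ((EuclideanSpace.proj i).comp (fderiv ℝ f x)) x :=
    (EuclideanSpace.proj (𝕜 := ℝ) i).hasFDerivAt.comp x hf.hasFDerivAt
  have h1 : HasFDerivAt (fun y ↦ ∑ i, sgn i * σ y i * τ y i) _ x :=
    HasFDerivAt.fun_sum fun i _ ↦ ((hc hσ' i).const_mul (sgn i)).mul (hc hτ' i)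
  have h2 := congr($(h1.fderiv) X)
  refine h2.trans ?_
  change _ = flatForm (fderiv ℝ σ x X) (τ x) + flatForm (σ x) (fderiv ℝ τ x X)
  rw [flatForm_apply, flatForm_apply, ← Finset.sum_add_distrib, sum_apply]
  refine Finset.sum_congr rfl fun i _ ↦ ?_
  simp
  ring

theorem smoothSection_flatConnection {σ : Π x, TE x} (hσ : SmoothSection σ) (X : Base 4) :
    SmoothSection fun x ↦ flatConnection σ x X := by
  have hσ' := (smoothSection_iff σ).1 hσ
  exact (smoothSection_iff _).2 ((hσ'.fderiv_right (m := ∞) (by simp)).clm_apply contDiff_const)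

theorem isFlatConnection_flat : IsFlatConnection flatConnection := by
  intro X Y σ hX hY hσ x
  have hσ' := (smoothSection_iff σ).1 hσ
  have hσ2 : ContDiff ℝ ∞ (fderiv ℝ σ) := hσ'.fderiv_right (by simp)
  have hd : DifferentiableAt ℝ (fderiv ℝ σ) x := hσ2.differentiable (by simp) x
  have hXd : DifferentiableAt ℝ X x := hX.differentiable (by simp) x
  have hYd : DifferentiableAt ℝ Y x := hY.differentiable (by simp) x
  change fderiv ℝ (fun y ↦ fderiv ℝ σ y (Y y)) x (X x) -
    fderiv ℝ (fun y ↦ fderiv ℝ σ y (X y)) x (Y x) -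
      fderiv ℝ σ x (VectorField.lieBracket ℝ X Y x) = 0
  have hsymm := (hσ'.contDiffAt (x := x)).isSymmSndFDerivAt
    (by simpa using WithTop.coe_le_coe.2 (le_top : (2 : ℕ∞) ≤ ⊤))
  rw [fderiv_clm_apply hd hYd, fderiv_clm_apply hd hXd, VectorField.lieBracket]
  simp [hsymm.eq (X x) (Y x)]

end FlatConnection

section CommonFrame

variable {J K : Base 4 → Base 4 →ₗ[ℝ] Base 4}
  (hJs : ∀ σ : Base 4 → Base 4, ContDiff ℝ ∞ σ → ContDiff ℝ ∞ fun x ↦ J x (σ x))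
  (hKs : ∀ σ : Base 4 → Base 4, ContDiff ℝ ∞ σ → ContDiff ℝ ∞ fun x ↦ K x (σ x))
  (hJ : ∀ x v, J x (J x v) = v) (hK : ∀ x v, K x (K x v) = v)
  (hJK : ∀ x v, J x (K x v) = K x (J x v))

include hJs hKs in
theorem contDiff_jointProj_apply (σ τ : ℝ) {s : Base 4 → Base 4} (hs : ContDiff ℝ ∞ s) :
    ContDiff ℝ ∞ fun x ↦ jointProj σ τ (J x) (K x) (s x) := by
  simp only [jointProj_apply]
  exact (((hs.add ((hKs s hs).const_smul _)).add ((hJs s hs).const_smul _)).add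
    ((hJs _ (hKs s hs)).const_smul _)).const_smul _

include hJs hKs hJ hK hJK

/-- The joint eigenline field of `J` and `K` for the eigenvalues `1` and `τ` has a smooth section
without zeros. -/
theorem exists_eigensection
    (htr : ∀ x (σ τ : ℝ), LinearMap.trace ℝ _ (jointProj σ τ (J x) (K x)) = 1)
    {τ : ℝ} (hτ : τ = 1 ∨ τ = -1) :
    ∃ u : Base 4 → Base 4, ContDiff ℝ ∞ u ∧ (∀ x, jointProj 1 τ (J x) (K x) (u x) = u x) ∧
      ∀ x, u x ≠ 0 := by
  refine exists_section_ne_zero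
    (P := fun x ↦ LinearMap.toContinuousLinearMap (jointProj 1 τ (J x) (K x))) ?_ ?_ ?_
  · exact contDiff_clm_apply_iff.2 fun v ↦
      contDiff_jointProj_apply hJs hKs 1 τ contDiff_const
  · exact fun x ↦ jointProj_idem (hJ x) (hK x) (hJK x) (Or.inl rfl) hτ
  · exact fun x ↦ exists_generator_of_trace_eq_one
      (jointProj_idem (hJ x) (hK x) (hJK x) (Or.inl rfl) hτ) (htr x 1 τ)

/-- The eigenline dual to that of `u` has a section paired with `u` to the constant `2`: the
projection of any `t` with `h(u, t) ≠ 0` can be normalised. -/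
theorem exists_dual_eigensection (hhJ : ∀ x v w, flatForm (J x v) (J x w) = -flatForm v w)
    (hhK : ∀ x v w, flatForm (K x v) (K x w) = -flatForm v w) {τ : ℝ} (hτ : τ = 1 ∨ τ = -1)
    {u : Base 4 → Base 4} (hu : ContDiff ℝ ∞ u)
    (hPu : ∀ x, jointProj 1 τ (J x) (K x) (u x) = u x) (hu0 : ∀ x, u x ≠ 0) :
    ∃ v : Base 4 → Base 4, ContDiff ℝ ∞ v ∧ (∀ x, flatForm (u x) (v x) = 2) ∧
      (∀ x, J x (v x) = -v x) ∧ ∀ x, K x (v x) = (-τ) • v x := by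
  -- `t x` is the vector which represents the Euclidean pairing with `u x` with respect to `h`.
  let t : Base 4 → Base 4 := fun x ↦ WithLp.toLp 2 fun i ↦ sgn i * u x i
  have ht : ContDiff ℝ ∞ t :=
    contDiff_euclidean.2 fun i ↦ contDiff_const.mul (contDiff_euclidean.1 hu i)
  have hut (x) : flatForm (u x) (t x) = ‖u x‖ ^ 2 := by
    rw [flatForm_apply, EuclideanSpace.real_norm_sq_eq]
    refine Finset.sum_congr rfl fun i _ ↦ ?_
    simp only [t]
    linear_combination u x i ^ 2 * sgn_mul_self i
  have hn (x) : ‖u x‖ ^ 2 ≠ 0 := pow_ne_zero 2 (norm_ne_zero_iff.2 (hu0 x))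
  have hP := contDiff_jointProj_apply hJs hKs (-1) (-τ) ht
  refine ⟨fun x ↦ (2 / ‖u x‖ ^ 2) • jointProj (-1) (-τ) (J x) (K x) (t x),
    (contDiff_const.div (hu.norm_sq ℝ) hn).smul hP, fun x ↦ ?_, fun x ↦ ?_, fun x ↦ ?_⟩
  · rw [map_smul, form_jointProj (hJ x) (hK x) (hJK x) (hhJ x) (hhK x), hPu, hut, smul_eq_mul,
      div_mul_cancel₀ _ (hn x)]
  · rw [map_smul, left_jointProj (hJ x) _ (Or.inr rfl)]
    module
  · have hτ' : -τ = 1 ∨ -τ = -1 := by rcases hτ with rfl | rfl <;> norm_num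
    rw [map_smul, right_jointProj (hK x) (hJK x) _ hτ']
    module

theorem exists_common_orthonormal_frame
    (htr : ∀ x (σ τ : ℝ), LinearMap.trace ℝ _ (jointProj σ τ (J x) (K x)) = 1)
    (hhJ : ∀ x v w, flatForm (J x v) (J x w) = -flatForm v w)
    (hhK : ∀ x v w, flatForm (K x v) (K x w) = -flatForm v w) :
    ∃ e : Fin 4 → Base 4 → Base 4, (∀ i, ContDiff ℝ ∞ (e i)) ∧
      ∀ x, (∀ i j, flatForm (e i x) (e j x) = if i = j then sgn i else 0) ∧
        IsAdapted 1 (J x) (fun i ↦ e i x) ∧ IsAdapted (-1) (K x) (fun i ↦ e i x) := by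
  -- The null vectors `u, w, v, z` have the eigenvalues `(1,1), (1,-1), (-1,-1), (-1,1)`.
  obtain ⟨u, hu, hPu, hu0⟩ := exists_eigensection hJs hKs hJ hK hJK htr (Or.inl rfl)
  obtain ⟨w, hw, hPw, hw0⟩ := exists_eigensection hJs hKs hJ hK hJK htr (Or.inr rfl)
  obtain ⟨v, hv, huv, hJv, hKv⟩ :=
    exists_dual_eigensection hJs hKs hJ hK hJK hhJ hhK (Or.inl rfl) hu hPu hu0
  obtain ⟨z, hz, hwz, hJz, hKz⟩ :=
    exists_dual_eigensection hJs hKs hJ hK hJK hhJ hhK (Or.inr rfl) hw hPw hw0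
  refine ⟨![fun x ↦ (1 / 2 : ℝ) • (u x + v x), fun x ↦ (1 / 2 : ℝ) • (w x + z x),
    fun x ↦ (1 / 2 : ℝ) • (u x - v x), fun x ↦ (1 / 2 : ℝ) • (z x - w x)], fun i ↦ ?_, fun x ↦ ?_⟩
  · fin_cases i
    · exact (hu.add hv).const_smul (1 / 2 : ℝ)
    · exact (hw.add hz).const_smul (1 / 2 : ℝ)
    · exact (hu.sub hv).const_smul (1 / 2 : ℝ)
    · exact (hz.sub hw).const_smul (1 / 2 : ℝ)
  · have hJu : J x (u x) = u x := by
      have := left_jointProj (hJ x) (K x) (Or.inl rfl) 1 (u x)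
      rwa [hPu, one_smul] at this
    have hKu : K x (u x) = u x := by
      have := right_jointProj (hK x) (hJK x) 1 (Or.inl rfl) (u x)
      rwa [hPu, one_smul] at this
    have hJw : J x (w x) = w x := by
      have := left_jointProj (hJ x) (K x) (Or.inl rfl) (-1) (w x)
      rwa [hPw, one_smul] at this
    have hKw : K x (w x) = -w x := by
      have := right_jointProj (hK x) (hJK x) 1 (Or.inr rfl) (w x)
      rwa [hPw, neg_one_smul] at this
    have hKv' : K x (v x) = -v x := by rw [hKv, neg_one_smul]
    have hKz' : K x (z x) = z x := by rw [hKz, neg_neg, one_smul]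
    have hsymm : ∀ a b, flatForm a b = flatForm b a := flatMetric.symm x
    have key := adapted_of_null_vectors hsymm (hhJ x) (hhK x) hJu hKu (hJv x) hKv' hJw hKw (hJz x)
      hKz' (huv x) (hwz x)
    have hb : (fun i ↦ (![fun x ↦ (1 / 2 : ℝ) • (u x + v x), fun x ↦ (1 / 2 : ℝ) • (w x + z x),
        fun x ↦ (1 / 2 : ℝ) • (u x - v x), fun x ↦ (1 / 2 : ℝ) • (z x - w x)] :
          Fin 4 → Base 4 → Base 4) i x) = ![(1 / 2 : ℝ) • (u x + v x), (1 / 2 : ℝ) • (w x + z x),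
        (1 / 2 : ℝ) • (u x - v x), (1 / 2 : ℝ) • (z x - w x)] := by
      funext i; fin_cases i <;> rfl
    refine ⟨fun i j ↦ ?_, ?_, ?_⟩
    · rw [congrFun hb i, congrFun hb j]
      exact key.1 i j
    · rw [hb]
      exact key.2.1
    · rw [hb]
      exact key.2.2

end CommonFrame

/-- An almost `+`-paracomplex and an almost `-`-paracomplex structure have a common adapted frame
on the whole of `ℝ^4`. -/
theorem exists_common_adapted_frame {J K : ∀ x : Base 4, TE x →ₗ[ℝ] TE x}
    (hJ : IsParacomplex flatMetric flatOrientation 1 J)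
    (hK : IsParacomplex flatMetric flatOrientation (-1) K) :
    ∃ e : Fin 4 → Π x, TE x, IsOrientedFrameOn flatMetric flatOrientation e univ ∧
      ∀ x, IsAdapted 1 (J x) (fun i ↦ e i x) ∧ IsAdapted (-1) (K x) (fun i ↦ e i x) := by
  have hpair (x) := hJ.exists_basis x
  have hpair' (x) := hK.exists_basis x
  choose b hb hbo hbJ using hpair
  choose b' hb' hbo' hbK using hpair'
  obtain ⟨e, hes, he⟩ := exists_common_orthonormal_frame (J := J) (K := K)
    (fun σ hσ ↦ (smoothSection_iff _).1 (hJ.smooth σ ((smoothSection_iff σ).2 hσ)))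
    (fun σ hσ ↦ (smoothSection_iff _).1 (hK.smooth σ ((smoothSection_iff σ).2 hσ))) hJ.sq hK.sq
    (fun x ↦ commute_of_isAdapted (hb x) (hb' x) ((hbo' x).trans (hbo x).symm) (hbJ x) (hbK x)
      (hK.sq x))
    (fun x ↦ trace_jointProj (hb x) (hb' x) ((hbo' x).trans (hbo x).symm) (hbJ x) (hbK x)
      (hK.sq x))
    hJ.reversing hK.reversing
  exact ⟨e, hJ.isOrientedFrameOn (by norm_num) (fun i ↦ (smoothSection_iff _).2 (hes i))
    (fun x ↦ (he x).1) (fun x ↦ (he x).2.1), fun x ↦ (he x).2⟩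

theorem isFullyLightLike_flat_iff {J K : ∀ x : Base 4, TE x →ₗ[ℝ] TE x}
    (hJ : IsParacomplex flatMetric flatOrientation 1 J)
    (hK : IsParacomplex flatMetric flatOrientation (-1) K) {Ωp Ωm : ∀ x : Base 4, ⋀[ℝ]^2 (TE x)}
    (hΩp : IsTwistorSection flatMetric flatOrientation 1 J Ωp)
    (hΩm : IsTwistorSection flatMetric flatOrientation (-1) K Ωm) :
    (IsFullyLightLike flatMetric flatConnection Ωp ∧
        IsFullyLightLike flatMetric flatConnection Ωm) ↔
      ∃ (e : Fin 4 → Π x, TE x) (he : IsOrientedFrameOn flatMetric flatOrientation e univ),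
        (∀ x, IsAdapted 1 (J x) (fun i ↦ e i x) ∧ IsAdapted (-1) (K x) (fun i ↦ e i x)) ∧
        HasShape (connForm flatConnection he.frame) := by
  have key {e : Fin 4 → Π x, TE x} (he : IsOrientedFrameOn flatMetric flatOrientation e univ)
      (had : ∀ x, IsAdapted 1 (J x) (fun i ↦ e i x) ∧ IsAdapted (-1) (K x) (fun i ↦ e i x)) :
      (IsFullyLightLike flatMetric flatConnection Ωp ∧
        IsFullyLightLike flatMetric flatConnection Ωm) ↔
      HasShape (connForm flatConnection he.frame) := by
    rw [hΩp.eq_omegaTwo he fun x ↦ (had x).1, hΩm.eq_omegaTwo he fun x ↦ (had x).2]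
    exact isFullyLightLike_iff_hasShape he.frame (fun x ↦ he.orthonormal x (mem_univ x))
      isMetricConnection_flat isFlatConnection_flat fun j X ↦
        smoothSection_flatConnection (IsLocalFrameOn.smoothSection he.frame j) X
  refine ⟨fun hll ↦ ?_, fun ⟨e, he, had, hΓ⟩ ↦ (key he had).2 hΓ⟩
  obtain ⟨e, he, had⟩ := exists_common_adapted_frame hJ hK
  exact ⟨e, he, had, (key he had).1 hll⟩

/-! ### Frames with prescribed connection form -/

section AdaptedEndomorphism

variable {W : Type*} [AddCommGroup W] [Module ℝ W] {h : LinearMap.BilinForm ℝ W}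
  {b : Module.Basis (Fin 4) ℝ W} {ε : ℝ} {J : W →ₗ[ℝ] W}

theorem apply_apply_of_isAdapted (hε : ε ^ 2 = 1) (hJ : IsAdapted ε J b) (v : W) :
    J (J v) = v := by
  obtain ⟨h0, h1, h2, h3⟩ := hJ
  refine LinearMap.congr_fun (b.ext (f₁ := J ∘ₗ J) (f₂ := LinearMap.id) fun i ↦ ?_) v
  fin_cases i <;> simp [h0, h1, h2, h3, smul_smul, ← sq, hε]

theorem form_apply_apply_of_isAdapted (hb : ∀ i j, h (b i) (b j) = if i = j then sgn i else 0)
    (hε : ε ^ 2 = 1) (hJ : IsAdapted ε J b) (v w : W) : h (J v) (J w) = -h v w := by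
  obtain ⟨h0, h1, h2, h3⟩ := hJ
  refine LinearMap.congr_fun₂ (b.ext fun i ↦ b.ext fun j ↦ ?_ : h.compl₁₂ J J = -h) v w
  fin_cases i <;> fin_cases j <;> simp [h0, h1, h2, h3, hb, sgn, ← sq, hε]

/-- The involution which fixes the space-like vectors of the basis and reverses the time-like ones
anticommutes with `J`, hence exchanges the two eigenspaces. -/
theorem finrank_eigenspace_of_isAdapted (hJ : IsAdapted ε J b) :
    Module.finrank ℝ (Module.End.eigenspace J 1) =
      Module.finrank ℝ (Module.End.eigenspace J (-1)) := by
  obtain ⟨h0, h1, h2, h3⟩ := hJ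
  have : Module.Finite ℝ W := b.finiteDimensional_of_finite
  let T : W →ₗ[ℝ] W := b.constr ℝ fun i ↦ sgn i • b i
  have hT (i) : T (b i) = sgn i • b i := b.constr_basis ℝ _ i
  have hTT (v) : T (T v) = v :=
    LinearMap.congr_fun (b.ext fun i ↦ by
      simp [hT, smul_smul, sgn_mul_self] : T ∘ₗ T = LinearMap.id) v
  have hJT (v) : J (T v) = -T (J v) := by
    refine LinearMap.congr_fun (b.ext fun i ↦ ?_ : J ∘ₗ T = -(T ∘ₗ J)) v
    fin_cases i <;> simp [h0, h1, h2, h3, hT, sgn]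
  have hle (c : ℝ) : Module.finrank ℝ (Module.End.eigenspace J c) ≤
      Module.finrank ℝ (Module.End.eigenspace J (-c)) := by
    refine (Submodule.equivMapOfInjective T
      (Function.LeftInverse.injective hTT) _).finrank_eq.trans_le ?_
    refine Submodule.finrank_mono (Submodule.map_le_iff_le_comap.2 fun v hv ↦ ?_)
    rw [Module.End.mem_eigenspace_iff] at hv
    rw [Submodule.mem_comap, Module.End.mem_eigenspace_iff, hJT, hv, map_smul, neg_smul]
  exact (hle 1).antisymm ((hle (-1)).trans_eq (by rw [neg_neg]))

end AdaptedEndomorphism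

/-- An oriented pseudo-orthonormal frame field on `ℝ^4` is adapted to a paracomplex structure of
either sign, given in the frame by the constant matrix of `IsAdapted`. -/
theorem exists_isParacomplex_of_frame {e : Fin 4 → Π x, TE x}
    (he : IsOrientedFrameOn flatMetric flatOrientation e univ) {ε : ℝ} (hε : ε ^ 2 = 1) :
    ∃ J : ∀ x : Base 4, TE x →ₗ[ℝ] TE x, IsParacomplex flatMetric flatOrientation ε J ∧
      ∀ x, IsAdapted ε (J x) (fun i ↦ e i x) := by
  let b (x : Base 4) : Module.Basis (Fin 4) ℝ (Base 4) := he.frame.toBasisAt (mem_univ x)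
  have hcoe (x i) : b x i = e i x := he.frame.toBasisAt_coe (mem_univ x) i
  have hon (x i j) : flatForm (b x i) (b x j) = if i = j then sgn i else 0 := by
    rw [hcoe, hcoe]
    exact he.orthonormal x (mem_univ x) i j
  let t (x : Base 4) : Fin 4 → Base 4 := ![b x 2, -ε • b x 3, b x 0, -ε • b x 1]
  let J (x : Base 4) : Base 4 →ₗ[ℝ] Base 4 := (b x).constr ℝ (t x)
  have hJb (x i) : J x (b x i) = t x i := (b x).constr_basis ℝ _ i
  have hJ (x) : IsAdapted ε (J x) (b x) := ⟨hJb x 0, hJb x 1, hJb x 2, hJb x 3⟩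
  have hbs (i) : ContDiff ℝ ∞ fun x ↦ b x i := by
    simp only [hcoe]
    exact (smoothSection_iff _).1 (IsLocalFrameOn.smoothSection he.frame i)
  have hts (i) : ContDiff ℝ ∞ fun x ↦ t x i := by
    fin_cases i
    · exact hbs 2
    · exact (hbs 3).const_smul (-ε)
    · exact hbs 0
    · exact (hbs 1).const_smul (-ε)
  have hJs (σ : Base 4 → Base 4) (hσ : ContDiff ℝ ∞ σ) : ContDiff ℝ ∞ fun x ↦ J x (σ x) := by
    have h1 : (fun x ↦ J x (σ x)) = fun x ↦ ∑ i, (sgn i * flatForm (b x i) (σ x)) • t x i := by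
      funext x
      conv_lhs => rw [eq_sum_form_smul (hon x) (σ x)]
      simp only [map_sum, map_smul, hJb]
    rw [h1]
    exact ContDiff.sum fun i _ ↦
      (contDiff_const.mul (contDiff_flatForm (hbs i) hσ)).smul (hts i)
  have hJe (x) : IsAdapted ε (J x) (fun i ↦ e i x) := by
    rw [← funext (hcoe x)]
    exact hJ x
  refine ⟨J, ⟨fun σ hσ ↦ ?_, fun x ↦ apply_apply_of_isAdapted hε (hJ x),
    fun x ↦ finrank_eigenspace_of_isAdapted (hJ x),
    fun x ↦ form_apply_apply_of_isAdapted (hon x) hε (hJ x),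
    fun x ↦ ⟨univ, isOpen_univ, mem_univ x, e, he, fun y _ ↦ hJe y⟩⟩, hJe⟩
  exact (smoothSection_iff _).2 (hJs σ ((smoothSection_iff σ).1 hσ))

section UnimodularFrames

/-- The determinant of two vectors of the plane. -/
def planeDet (a b : Fin 2 → ℝ) : ℝ := a 0 * b 1 - a 1 * b 0

/-- The linear system for a unimodular frame of the plane whose connection form has the diagonal
entries `± df / 2` and a single off-diagonal entry `e^{ν f} dg`, above or below the diagonal
according to the sign `ν`, has an explicit solution. -/
theorem exists_unimodular_frame {f g : Base 4 → ℝ} (hf : ContDiff ℝ ∞ f) (hg : ContDiff ℝ ∞ g)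
    {ν : ℝ} (hν : ν = 1 ∨ ν = -1) :
    ∃ p q : Base 4 → Fin 2 → ℝ, ContDiff ℝ ∞ p ∧ ContDiff ℝ ∞ q ∧
      (∀ x, planeDet (p x) (q x) = 1) ∧
      (∀ x X, fderiv ℝ p x X = (1 / 2 * fderiv ℝ f x X) • p x +
        ((1 + ν) / 2 * (Real.exp (ν * f x) * fderiv ℝ g x X)) • q x) ∧
      ∀ x X, fderiv ℝ q x X = (-(1 / 2) * fderiv ℝ f x X) • q x +
        ((1 - ν) / 2 * (Real.exp (ν * f x) * fderiv ℝ g x X)) • p x := by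
  have hs (c d : ℝ) (y z : Fin 2 → ℝ) :
      ContDiff ℝ ∞ fun x ↦ Real.exp (c * f x) • (y + (d * g x) • z) :=
    (Real.contDiff_exp.comp (contDiff_const.mul hf)).smul
      (contDiff_const.add ((contDiff_const.mul hg).smul contDiff_const))
  have hd (c d : ℝ) (y z : Fin 2 → ℝ) (x X) :
      fderiv ℝ (fun x ↦ Real.exp (c * f x) • (y + (d * g x) • z)) x X =
        (c * fderiv ℝ f x X) • (Real.exp (c * f x) • (y + (d * g x) • z)) +
          (Real.exp (c * f x) * (d * fderiv ℝ g x X)) • z := by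
    have hf' := (hf.differentiable (by simp) x).hasFDerivAt
    have hg' := (hg.differentiable (by simp) x).hasFDerivAt
    have h1 := ((hf'.const_mul c).exp).fun_smul (((hg'.const_mul d).smul_const z).const_add y)
    rw [h1.fderiv]
    simp
    module
  refine ⟨fun x ↦ Real.exp (1 / 2 * f x) • (![1, 0] + ((1 + ν) / 2 * g x) • ![0, 1]),
    fun x ↦ Real.exp (-(1 / 2) * f x) • (![0, 1] + ((1 - ν) / 2 * g x) • ![1, 0]),
    hs _ _ _ _, hs _ _ _ _, fun x ↦ ?_, fun x X ↦ ?_, fun x X ↦ ?_⟩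
  · have h1 : Real.exp (1 / 2 * f x) * Real.exp (-(1 / 2) * f x) = 1 := by
      rw [← Real.exp_add]; simp
    rcases hν with rfl | rfl <;> simp [planeDet] <;> simpa using h1
  · rw [hd]
    rcases hν with rfl | rfl
    · have h1 : Real.exp (1 * f x) * Real.exp (-(1 / 2) * f x) = Real.exp (1 / 2 * f x) := by
        rw [← Real.exp_add]; ring_nf
      congr 1
      rw [← h1]
      module
    · simp
  · rw [hd]
    rcases hν with rfl | rfl
    · simp
    · have h1 : Real.exp (-1 * f x) * Real.exp (1 / 2 * f x) = Real.exp (-(1 / 2) * f x) := by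
        rw [← Real.exp_add]; ring_nf
      congr 1
      rw [← h1]
      module

end UnimodularFrames

section TensorFrames

/-- An identification of `ℝ² ⊗ ℝ²` with `E^4_2` under which the neutral metric is `-2` times the
tensor product of the determinants. -/
def planeTensor : (Fin 2 → ℝ) →ₗ[ℝ] (Fin 2 → ℝ) →ₗ[ℝ] Base 4 :=
  LinearMap.mk₂ ℝ (fun a b ↦ !₂[a 0 * b 0 - a 1 * b 1, a 1 * b 0 + a 0 * b 1,
      a 0 * b 0 + a 1 * b 1, a 1 * b 0 - a 0 * b 1])
    (fun a a' b ↦ by ext i; fin_cases i <;> simp <;> ring)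
    (fun c a b ↦ by ext i; fin_cases i <;> simp <;> ring)
    (fun a b b' ↦ by ext i; fin_cases i <;> simp <;> ring)
    (fun c a b ↦ by ext i; fin_cases i <;> simp <;> ring)

theorem planeTensor_apply (a b : Fin 2 → ℝ) :
    planeTensor a b = !₂[a 0 * b 0 - a 1 * b 1, a 1 * b 0 + a 0 * b 1,
      a 0 * b 0 + a 1 * b 1, a 1 * b 0 - a 0 * b 1] := rfl

theorem flatForm_planeTensor (a b c d : Fin 2 → ℝ) :
    flatForm (planeTensor a b) (planeTensor c d) = -2 * (planeDet a c * planeDet b d) := by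
  simp [flatForm_apply, planeTensor_apply, planeDet, Fin.sum_univ_four, sgn]
  ring

theorem contDiff_planeTensor {a b : Base 4 → Fin 2 → ℝ} (ha : ContDiff ℝ ∞ a)
    (hb : ContDiff ℝ ∞ b) : ContDiff ℝ ∞ fun x ↦ planeTensor (a x) (b x) :=
  (planeTensor.toContinuousBilinearMap.isBoundedBilinearMap.contDiff).comp (ha.prodMk hb)

theorem hasFDerivAt_planeTensor {a b : Base 4 → Fin 2 → ℝ} (ha : ContDiff ℝ ∞ a)
    (hb : ContDiff ℝ ∞ b) (x : Base 4) :
    ∃ L : Base 4 →L[ℝ] Base 4, HasFDerivAt (fun x ↦ planeTensor (a x) (b x)) L x ∧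
      ∀ X, L X = planeTensor (fderiv ℝ a x X) (b x) + planeTensor (a x) (fderiv ℝ b x X) :=
  ⟨_, planeTensor.toContinuousBilinearMap.hasFDerivAt_of_bilinear
    (ha.differentiable (by simp) x).hasFDerivAt (hb.differentiable (by simp) x).hasFDerivAt,
    fun X ↦ add_comm _ _⟩

/-- The basis of `E^4_2` made from two bases `p, q` and `r, s` of the plane: the four tensors are
null vectors. -/
def tensorFrame (p q r s : Fin 2 → ℝ) : Fin 4 → Base 4 :=
  ![(1 / 2 : ℝ) • (planeTensor p r - planeTensor q s),
    (1 / 2 : ℝ) • (planeTensor p s + planeTensor q r),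
    (1 / 2 : ℝ) • (planeTensor p r + planeTensor q s),
    (1 / 2 : ℝ) • (planeTensor q r - planeTensor p s)]

theorem flatForm_tensorFrame {p q r s : Fin 2 → ℝ} (hpq : planeDet p q = 1)
    (hrs : planeDet r s = 1) (i j : Fin 4) :
    flatForm (tensorFrame p q r s i) (tensorFrame p q r s j) = if i = j then sgn i else 0 := by
  have h1 (a : Fin 2 → ℝ) : planeDet a a = 0 := by simp [planeDet, mul_comm]
  have h2 : planeDet q p = -1 := by rw [← hpq]; simp only [planeDet]; ring
  have h3 : planeDet s r = -1 := by rw [← hrs]; simp only [planeDet]; ring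
  fin_cases i <;> fin_cases j <;>
    simp [tensorFrame, flatForm_planeTensor, h1, h2, h3, hpq, hrs, sgn] <;> norm_num

theorem det_tensorFrame (p q r s : Fin 2 → ℝ) :
    (Matrix.of fun i j ↦ tensorFrame p q r s j i).det = planeDet p q ^ 2 * planeDet r s ^ 2 := by
  rw [det_fin_four]
  simp [tensorFrame, planeTensor_apply, planeDet]
  ring

theorem smoothSection_tensorFrame {p q r s : Base 4 → Fin 2 → ℝ} (hp : ContDiff ℝ ∞ p)
    (hq : ContDiff ℝ ∞ q) (hr : ContDiff ℝ ∞ r) (hs : ContDiff ℝ ∞ s) (i : Fin 4) :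
    SmoothSection (V := TE) fun x ↦ tensorFrame (p x) (q x) (r x) (s x) i := by
  refine (smoothSection_iff _).2 ?_
  have pr := contDiff_planeTensor hp hr
  have ps := contDiff_planeTensor hp hs
  have qr := contDiff_planeTensor hq hr
  have qs := contDiff_planeTensor hq hs
  fin_cases i
  · exact (pr.sub qs).const_smul (1 / 2 : ℝ)
  · exact (ps.add qr).const_smul (1 / 2 : ℝ)
  · exact (pr.add qs).const_smul (1 / 2 : ℝ)
  · exact (qr.sub ps).const_smul (1 / 2 : ℝ)

theorem isOrientedFrameOn_tensorFrame {p q r s : Base 4 → Fin 2 → ℝ} (hp : ContDiff ℝ ∞ p)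
    (hq : ContDiff ℝ ∞ q) (hr : ContDiff ℝ ∞ r) (hs : ContDiff ℝ ∞ s)
    (hpq : ∀ x, planeDet (p x) (q x) = 1) (hrs : ∀ x, planeDet (r x) (s x) = 1) :
    IsOrientedFrameOn flatMetric flatOrientation
      (fun i x ↦ tensorFrame (p x) (q x) (r x) (s x) i) univ where
  frame := isLocalFrameOn_of_orthonormal flatMetric (smoothSection_tensorFrame hp hq hr hs)
    fun x ↦ flatForm_tensorFrame (hpq x) (hrs x)
  orthonormal x _ := flatForm_tensorFrame (hpq x) (hrs x)
  oriented x hx := by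
    refine ((Module.Basis.orientation_eq_iff_det_pos _ _).2 ?_).symm
    have h1 : (isLocalFrameOn_std.toBasisAt hx : Module.Basis (Fin 4) ℝ (Base 4)) =
        (EuclideanSpace.basisFun (Fin 4) ℝ).toBasis :=
      Module.Basis.eq_of_apply_eq fun i ↦ (isLocalFrameOn_std.toBasisAt_coe hx i).trans
        (congrFun (EuclideanSpace.basisFun (Fin 4) ℝ).coe_toBasis i).symm
    have h2 := det_tensorFrame (p x) (q x) (r x) (s x)
    rw [hpq, hrs, one_pow, one_mul] at h2
    have h3 : (isLocalFrameOn_std.toBasisAt hx).det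
        (fun i ↦ tensorFrame (p x) (q x) (r x) (s x) i) = 1 := by
      refine Eq.trans ?_ h2
      erw [h1]
      rfl
    have h4 := funext fun i ↦ (isLocalFrameOn_of_orthonormal flatMetric
      (smoothSection_tensorFrame hp hq hr hs)
      fun x ↦ flatForm_tensorFrame (hpq x) (hrs x)).toBasisAt_coe hx i
    rw [h4]
    exact h3.symm ▸ one_pos

variable {p q r s : Base 4 → Fin 2 → ℝ} {a b c a' b' c' : Base 4 → Base 4 → ℝ}

/-- The connection form of a tensor frame, for planar frames with connection forms of trace zero:
by the Leibniz rule, `sl(2) ⊕ sl(2)` is identified with `so(2,2)`. -/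
theorem connForm_tensorFrame (hp : ContDiff ℝ ∞ p) (hq : ContDiff ℝ ∞ q) (hr : ContDiff ℝ ∞ r)
    (hs : ContDiff ℝ ∞ s) (hpq : ∀ x, planeDet (p x) (q x) = 1)
    (hrs : ∀ x, planeDet (r x) (s x) = 1)
    (hdp : ∀ x X, fderiv ℝ p x X = a x X • p x + b x X • q x)
    (hdq : ∀ x X, fderiv ℝ q x X = (-a x X) • q x + c x X • p x)
    (hdr : ∀ x X, fderiv ℝ r x X = a' x X • r x + b' x X • s x)
    (hds : ∀ x X, fderiv ℝ s x X = (-a' x X) • s x + c' x X • r x) (x X : Base 4) :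
    let Γ := connForm flatConnection (isOrientedFrameOn_tensorFrame hp hq hr hs hpq hrs).frame
    (Γ 2 0 x X = a x X + a' x X ∧ Γ 3 1 x X = a' x X - a x X) ∧
      Γ 1 0 x X = 1 / 2 * ((b x X - c x X) + (b' x X - c' x X)) ∧
      Γ 2 1 x X = 1 / 2 * ((b x X + c x X) + (b' x X + c' x X)) ∧
      Γ 3 0 x X = 1 / 2 * ((b x X + c x X) - (b' x X + c' x X)) ∧
      Γ 3 2 x X = 1 / 2 * ((b x X - c x X) - (b' x X - c' x X)) := by
  intro Γ
  have he := isOrientedFrameOn_tensorFrame hp hq hr hs hpq hrs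
  have hΓ (i j) : Γ i j x X = sgn i * flatForm (tensorFrame (p x) (q x) (r x) (s x) i)
      (fderiv ℝ (fun y ↦ tensorFrame (p y) (q y) (r y) (s y) j) x X) :=
    connForm_eq_form he.frame (fun x ↦ he.orthonormal x (mem_univ x)) i j x X
  obtain ⟨P, hP, hP'⟩ := hasFDerivAt_planeTensor hp hr x
  obtain ⟨Q, hQ, hQ'⟩ := hasFDerivAt_planeTensor hp hs x
  obtain ⟨R, hR, hR'⟩ := hasFDerivAt_planeTensor hq hr x
  obtain ⟨S, hS, hS'⟩ := hasFDerivAt_planeTensor hq hs x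
  have d0 : fderiv ℝ (fun y ↦ tensorFrame (p y) (q y) (r y) (s y) 0) x X =
      (1 / 2 : ℝ) • (P X - S X) :=
    congr($(((hP.sub hS).const_smul (1 / 2 : ℝ)).fderiv) X)
  have d1 : fderiv ℝ (fun y ↦ tensorFrame (p y) (q y) (r y) (s y) 1) x X =
      (1 / 2 : ℝ) • (Q X + R X) :=
    congr($(((hQ.add hR).const_smul (1 / 2 : ℝ)).fderiv) X)
  have d2 : fderiv ℝ (fun y ↦ tensorFrame (p y) (q y) (r y) (s y) 2) x X =
      (1 / 2 : ℝ) • (P X + S X) :=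
    congr($(((hP.add hS).const_smul (1 / 2 : ℝ)).fderiv) X)
  have h1 (a : Fin 2 → ℝ) : planeDet a a = 0 := by simp [planeDet, mul_comm]
  have h2 : planeDet (q x) (p x) = -1 := by rw [← hpq x]; simp only [planeDet]; ring
  have h3 : planeDet (s x) (r x) = -1 := by rw [← hrs x]; simp only [planeDet]; ring
  simp only [hΓ, d0, d1, d2, hP', hQ', hR', hS', hdp, hdq, hdr, hds]
  simp only [tensorFrame, sgn, Matrix.cons_val, map_add, map_sub, map_smul, LinearMap.add_apply,
    LinearMap.sub_apply, LinearMap.smul_apply, flatForm_planeTensor, h1, h2, h3, hpq, hrs,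
    smul_eq_mul]
  refine ⟨⟨?_, ?_⟩, ?_, ?_, ?_, ?_⟩ <;> ring

/-- The signs of the two factors can be prescribed independently. The connection form of the tensor
frame involves the potentials of the two factors through `f + f'` and `f - f'`, and the second one
is taken to be `f' = -f⁻`. -/
theorem exists_frame_of_data {fp fm gp gm : Base 4 → ℝ} (hfp : ContDiff ℝ ∞ fp)
    (hfm : ContDiff ℝ ∞ fm) (hgp : ContDiff ℝ ∞ gp) (hgm : ContDiff ℝ ∞ gm) {ν ν' : ℝ}
    (hν : ν = 1 ∨ ν = -1) (hν' : ν' = 1 ∨ ν' = -1) :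
    ∃ (e : Fin 4 → Π x, TE x) (he : IsOrientedFrameOn flatMetric flatOrientation e univ),
      CommonShape fp fm (connForm flatConnection he.frame) ∧ ∀ x X,
        let Γ := connForm flatConnection he.frame
        let θ := Real.exp (ν * fp x) * fderiv ℝ gp x X
        let θ' := Real.exp (-ν' * fm x) * fderiv ℝ gm x X
        Γ 1 0 x X = 1 / 2 * (ν * θ + ν' * θ') ∧ Γ 2 1 x X = 1 / 2 * (θ + θ') ∧
          Γ 3 0 x X = 1 / 2 * (θ - θ') ∧ Γ 3 2 x X = 1 / 2 * (ν * θ - ν' * θ') := by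
  obtain ⟨p, q, hp, hq, hpq, hdp, hdq⟩ := exists_unimodular_frame hfp hgp hν
  obtain ⟨r, s, hr, hs, hrs, hdr, hds⟩ := exists_unimodular_frame hfm.neg hgm hν'
  have key := connForm_tensorFrame hp hq hr hs hpq hrs hdp
    (fun x X ↦ by rw [hdq, neg_mul]) hdr (fun x X ↦ by rw [hds, neg_mul])
  have hd (x X : Base 4) : fderiv ℝ (fun y ↦ -fm y) x X = -fderiv ℝ fm x X := by
    rw [fderiv_fun_neg, neg_apply]
  refine ⟨_, isOrientedFrameOn_tensorFrame hp hq hr hs hpq hrs, fun x X ↦ ?_, fun x X ↦ ?_⟩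
  · obtain ⟨⟨h1, h2⟩, -⟩ := key x X
    rw [h1, h2, hd]
    constructor <;> ring
  · obtain ⟨-, h1, h2, h3, h4⟩ := key x X
    intro Γ θ θ'
    have hθ : Real.exp (ν' * -fm x) * fderiv ℝ gm x X = θ' := by rw [mul_neg, ← neg_mul]
    refine ⟨h1.trans ?_, h2.trans ?_, h3.trans ?_, h4.trans ?_⟩ <;> rw [hθ] <;> ring

end TensorFrames

theorem exists_isParacomplex_of_data {μ : ℝ} {fp fm gp gm : Base 4 → ℝ} (hμ : μ = 1 ∨ μ = -1)
    (hdata : IsData fp fm gp gm) :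
    ∀ Shape ∈ [ShapeOne μ fp fm gp gm, ShapeTwo μ fp fm gp gm],
      ∃ (Jp Jm : ∀ x : Base 4, TE x →ₗ[ℝ] TE x) (e : Fin 4 → Π x, TE x)
        (he : IsOrientedFrameOn flatMetric flatOrientation e univ),
        IsParacomplex flatMetric flatOrientation 1 Jp ∧
        IsParacomplex flatMetric flatOrientation (-1) Jm ∧
        (∀ x, IsAdapted 1 (Jp x) (fun i ↦ e i x) ∧ IsAdapted (-1) (Jm x) (fun i ↦ e i x)) ∧
        CommonShape fp fm (connForm flatConnection he.frame) ∧
        Shape (connForm flatConnection he.frame) := by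
  intro Shape hShape
  obtain ⟨hfp, hfm, hgp, hgm, -, -⟩ := hdata
  have hμ' : -μ = 1 ∨ -μ = -1 := by rcases hμ with rfl | rfl <;> norm_num
  suffices ∃ (e : Fin 4 → Π x, TE x) (he : IsOrientedFrameOn flatMetric flatOrientation e univ),
      CommonShape fp fm (connForm flatConnection he.frame) ∧
      Shape (connForm flatConnection he.frame) by
    obtain ⟨e, he, h1, h2⟩ := this
    obtain ⟨Jp, hp, hpe⟩ := exists_isParacomplex_of_frame he (ε := 1) (by norm_num)
    obtain ⟨Jm, hm, hme⟩ := exists_isParacomplex_of_frame he (ε := -1) (by norm_num)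
    exact ⟨Jp, Jm, e, he, hp, hm, fun x ↦ ⟨hpe x, hme x⟩, h1, h2⟩
  simp only [List.mem_cons, List.not_mem_nil, or_false] at hShape
  -- The second sign is `-μ` in the first shape and `μ` in the second one.
  rcases hShape with rfl | rfl
  · obtain ⟨e, he, h1, h2⟩ := exists_frame_of_data hfp hfm hgp hgm hμ hμ'
    refine ⟨e, he, h1, fun x X ↦ ?_⟩
    obtain ⟨h3, h4, h5, h6⟩ := h2 x X
    rw [neg_neg] at h3 h4 h5 h6
    exact ⟨h3.trans (by ring), h4, h5, h6.trans (by ring)⟩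
  · obtain ⟨e, he, h1, h2⟩ := exists_frame_of_data hfp hfm hgp hgm hμ hμ
    refine ⟨e, he, h1, fun x X ↦ ?_⟩
    obtain ⟨h3, h4, h5, h6⟩ := h2 x X
    exact ⟨h3.trans (by ring), h4, h5, h6.trans (by ring)⟩

end NeutralRankFour

end

open NeutralRankFour in
theorem mainTheorem4 :
    -- the characterisation for a rank-4 bundle with a flat metric connection
    (∀ (m : ℕ) (_ : 2 ≤ m)
      (V : Base m → Type*) [TopologicalSpace (TotalSpace Fib V)]
      [∀ x, AddCommGroup (V x)] [∀ x, Module ℝ (V x)] [∀ x, TopologicalSpace (V x)]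
      [∀ x, IsTopologicalAddGroup (V x)] [∀ x, ContinuousSMul ℝ (V x)]
      [FiberBundle Fib V] [VectorBundle ℝ Fib V] [ContMDiffVectorBundle ∞ Fib V 𝓘(ℝ, Base m)]
      (h : NeutralMetric V) (o : BundleOrientation V)
      (cov : CovariantDerivative 𝓘(ℝ, Base m) Fib V) (_ : cov.ContMDiffCovariantDerivative ∞)
      (_ : IsMetricConnection h cov) (_ : IsFlatConnection cov)
      (e : Fin 4 → Π x, V x) (he : IsOrientedFrameOn h o e univ),
      (IsFullyLightLike h cov (fun x ↦ omegaTwo 1 (fun i ↦ e i x)) ∧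
          IsFullyLightLike h cov (fun x ↦ omegaTwo (-1) (fun i ↦ e i x))) ↔
        HasShape (connForm cov he.frame)) ∧
    -- all pairs of almost paracomplex structures of `E^4_2`
    (∀ Jp Jm : ∀ x : Base 4, TE x →ₗ[ℝ] TE x,
      IsParacomplex flatMetric flatOrientation 1 Jp →
      IsParacomplex flatMetric flatOrientation (-1) Jm →
      ∀ Ωp Ωm : ∀ x : Base 4, ⋀[ℝ]^2 (TE x),
        IsTwistorSection flatMetric flatOrientation 1 Jp Ωp →
        IsTwistorSection flatMetric flatOrientation (-1) Jm Ωm →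
        ((IsFullyLightLike flatMetric flatConnection Ωp ∧
            IsFullyLightLike flatMetric flatConnection Ωm) ↔
          ∃ (e : Fin 4 → Π x, TE x) (he : IsOrientedFrameOn flatMetric flatOrientation e univ),
            (∀ x, IsAdapted 1 (Jp x) (fun i ↦ e i x) ∧ IsAdapted (-1) (Jm x) (fun i ↦ e i x)) ∧
            HasShape (connForm flatConnection he.frame))) ∧
    -- each choice of the data, of the sign and of the type is realised by such a pair
    (∀ (μ : ℝ) (fp fm gp gm : Base 4 → ℝ), (μ = 1 ∨ μ = -1) → IsData fp fm gp gm →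
      ∀ Shape ∈ [ShapeOne μ fp fm gp gm, ShapeTwo μ fp fm gp gm],
        ∃ (Jp Jm : ∀ x : Base 4, TE x →ₗ[ℝ] TE x) (e : Fin 4 → Π x, TE x)
          (he : IsOrientedFrameOn flatMetric flatOrientation e univ),
          IsParacomplex flatMetric flatOrientation 1 Jp ∧
          IsParacomplex flatMetric flatOrientation (-1) Jm ∧
          (∀ x, IsAdapted 1 (Jp x) (fun i ↦ e i x) ∧ IsAdapted (-1) (Jm x) (fun i ↦ e i x)) ∧
          CommonShape fp fm (connForm flatConnection he.frame) ∧
          Shape (connForm flatConnection he.frame)) := by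
  refine ⟨fun m _ V _ _ _ _ _ _ _ _ _ h o cov hsm hcov hflat e he ↦ ?_,
    fun Jp Jm hJp hJm Ωp Ωm hΩp hΩm ↦ isFullyLightLike_flat_iff hJp hJm hΩp hΩm,
    fun μ fp fm gp gm hμ hdata ↦ exists_isParacomplex_of_data hμ hdata⟩
  exact isFullyLightLike_iff_hasShape he.frame (fun x ↦ he.orthonormal x (mem_univ x)) hcov hflat
    fun j X ↦ smoothSection_cov hsm (IsLocalFrameOn.smoothSection he.frame j) X
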